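/- **Conventions.** For $0<\epsilon<1$ let $q'=\epsilon$, $q=\sqrt{1-\epsilon^2}$; $\mathrm{sn},\mathrm{cn},\mathrm{dn}$ are the Jacobi elliptic functions of modulus $q$, and $K$, $K'$ are the complete elliptic integrals of modulus $q$ and $q'$. For a central variable $\beta$ (resp. $\gamma$) and four neighbouring variables put $$P^{s}(\beta;\beta_1,\dots,\beta_4)=\prod_{k=1}^4\frac{\mathrm{sn}\frac{\beta-\beta_k+iK'}{2}}{\mathrm{sn}\frac{\beta+\beta_k+iK'}{2}},\qquad P^{h}(\gamma;\gamma_1,\dots,\gamma_4)=\prod_{k=1}^4\frac{\mathrm{sn}\frac{\gamma-\gamma_k+iK'}{2}}{\mathrm{sn}\frac{\gamma+\gamma_k-iK'}{2}} .$$ The spherical and hyperbolic ring equations are $P^s=1$ and $P^h=1$. The variable $\beta\in[0,2K]$ of a spherical ring with (signed) inner radius $r$ and outer radius $R$ is given by $\cos r=\mathrm{sn}\,\beta$, $\sin r=\mathrm{cn}\,\beta$, $\sin R=\mathrm{dn}\,\beta$; the variable $\gamma\in(0,2K)$ of a hyperbolic ring by $\sinh r=\mathrm{cn}\,\gamma/\mathrm{sn}\,\gamma$,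 $\cosh R=1/(q\,\mathrm{sn}\,\gamma)$, $\tanh R=\mathrm{dn}\,\gamma$. **Theorem.** (1) Let $u,u_1,\dots,u_4\in\mathbb R$ depend on $\epsilon$ with $|u|\le M$, $|u_k-u|\le A\epsilon$, $|\sum_{k}(u_k-u)|\le B\epsilon^2$, and let $\beta=K-u$, $\beta_k=K-u_k$, $\gamma=K-u$, $\gamma_k=K-u_k$. Then, as $\epsilon\to0$, with constants depending only on $M,A,B$, $$\frac{P^{s}-1}{\epsilon^2}=-i\Big(\epsilon^{-2}\sum_{k}(u_k-u)+\sinh 2u\Big)+O(\epsilon),\qquad \frac{P^{h}-1}{\epsilon^2}=-i\Big(\epsilon^{-2}\sum_{k}(u_k-u)-\sinh 2u\Big)+O(\epsilon).$$ Now let $U\subset\mathbb R^2$ be open, $u\in C^3(U)$ real-valued and $S\subset U$ compact. All estimates below are uniform in $(x,y)\in S$, for all sufficiently small $\epsilon>0$; the five rings belong to the points $(x,y)$ (the centre) and $(x\pm\epsilon,y)$, $(x,y\pm\epsilon)$ (its neighbours), which lie in $U$. (2) If the values of $u$ at these five points are inserted in (1), then $$\frac{P^{s}-1}{\epsilon^2}=-i\,(\Delta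 u+\sinh 2u)(x,y)+O(\epsilon),\qquad \frac{P^{h}-1}{\epsilon^2}=-i\,(\Delta u-\sinh 2u)(x,y)+O(\epsilon),$$ so that the spherical and the hyperbolic ring equations are approximations of the elliptic sinh-Gordon equations $\Delta u+\sinh 2u=0$ and $\Delta u-\sinh 2u=0$ respectively. (3) Let $\Delta u+\sinh 2u=0$ in $U$ and take five spherical rings with radii $r=\epsilon\sinh u$, $R=\epsilon\cosh u$, where $u$ is evaluated at the five points. For each of them there is exactly one $\beta\in[0,2K]$ with $\cos r=\mathrm{sn}\,\beta$, $\sin r=\mathrm{cn}\,\beta$; it satisfies $\sin R=\mathrm{dn}\,\beta+O(\epsilon^3)$; and these variables satisfy the spherical ring equation up to $O(\epsilon)$ in the sense that $(P^{s}-1)/\epsilon^2=O(\epsilon)$. The five rings form an infinitesimal spherical ring flower: $|r|<R<\pi/2$ for each ring, each neighbour (radii $r_k,R_k$) intersects the central ring (radii $r,R$) orthogonally up to a small error, $\cos R\cos r_k-\cos r\cos R_k=O(\epsilon^5)$, and the opening angles $\theta_k=\arctan\frac{\tan R_k}{\sin r}+\arctan\frac{\tan r_k}{\sin R}$ at the centre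 close up, $\sum_{k=1}^4\theta_k=\pm2\pi+O(\epsilon^3)$. Here the sign is $+$ if $r\ge0$ and $-$ if $r<0$, and for $r=0$ the first arctangent is $\pi/2$. (4) Let $\Delta u-\sinh 2u=0$ in $U$ and take five hyperbolic rings with radii $r=\epsilon\sinh u$, $R=\epsilon\cosh u$ at the five points. For each of them there is exactly one $\gamma\in(0,2K)$ with $\sinh r=\mathrm{cn}\,\gamma/\mathrm{sn}\,\gamma$; it satisfies $\cosh R=1/(q\,\mathrm{sn}\,\gamma)+O(\epsilon^3)$ and $\tanh R=\mathrm{dn}\,\gamma+O(\epsilon^3)$; and $(P^{h}-1)/\epsilon^2=O(\epsilon)$. The five rings form an infinitesimal hyperbolic ring flower: $|r|<R$ for each ring, $\cosh R\cosh r_k-\cosh r\cosh R_k=O(\epsilon^5)$, and $\sum_{k=1}^4\theta_k=\pm2\pi+O(\epsilon^3)$ for $\theta_k=\arctan\frac{\tanh R_k}{\sinh r}+\arctan\frac{\tanh r_k}{\sinh R}$, with the same conventions for the sign and for $r=0$. -/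

import Mathlib

noncomputable section

namespace RingPattern

/-! ### Jacobi elliptic functions of modulus `k`, `|k| < 1` -/

/-- The incomplete elliptic integral of the first kind `F(φ, k)`. -/
def ellipticF (k φ : ℝ) : ℝ :=
  ∫ θ in (0 : ℝ)..φ, 1 / √(1 - k ^ 2 * Real.sin θ ^ 2)

/-- The complete elliptic integral of the first kind, the quarter period `K(k)`. -/
def ellipticK (k : ℝ) : ℝ := ellipticF k (Real.pi / 2)

/-- The complementary modulus `k' = √(1 - k²)`. -/
def complMod (k : ℝ) : ℝ := √(1 - k ^ 2)

/-- The complementary quarter period `K'(k) = K(k')`. -/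
def ellipticK' (k : ℝ) : ℝ := ellipticK (complMod k)

/-- The Jacobi amplitude: the inverse of the bijection `φ ↦ F(φ, k)` of the real line. -/
def am (k x : ℝ) : ℝ := Function.invFun (ellipticF k) x

/-- The real Jacobi function `sn`. -/
def sn (k x : ℝ) : ℝ := Real.sin (am k x)

/-- The real Jacobi function `cn`. -/
def cn (k x : ℝ) : ℝ := Real.cos (am k x)

/-- The real Jacobi function `dn` (positive on the real line). -/
def dn (k x : ℝ) : ℝ := √(1 - k ^ 2 * sn k x ^ 2)

/-- The Jacobi function `sn` of a complex argument `z = x + i y`, through its classical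
expression by real Jacobi functions of `x` with modulus `k` and of `y` with modulus `k'`:
`sn (x + i y) = (s d₁ + i c d s₁ c₁) / (1 - d² s₁²)`
(the addition theorem together with Jacobi's imaginary transformation). -/
def csn (k : ℝ) (z : ℂ) : ℂ :=
  ((sn k z.re * dn (complMod k) z.im : ℝ) +
      (cn k z.re * dn k z.re * sn (complMod k) z.im * cn (complMod k) z.im : ℝ) * Complex.I) /
    ((1 - dn k z.re ^ 2 * sn (complMod k) z.im ^ 2 : ℝ) : ℂ)

/-- For `|k| < 1` the function `F(·, k)` is a bijection of the real line, so that `am` is its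
two-sided inverse. -/
theorem ellipticF_bijective {k : ℝ} (hk : k ^ 2 < 1) : Function.Bijective (ellipticF k) := by
  have hpos : ∀ θ : ℝ, 0 < 1 - k ^ 2 * Real.sin θ ^ 2 := fun θ => by
    nlinarith [Real.sin_sq_le_one θ, sq_nonneg k, sq_nonneg (Real.sin θ)]
  have hle : ∀ θ : ℝ, 1 ≤ 1 / √(1 - k ^ 2 * Real.sin θ ^ 2) := fun θ => by
    rw [le_div_iff₀ (Real.sqrt_pos.2 (hpos θ)), one_mul]
    exact Real.sqrt_le_one.2 (by nlinarith [mul_nonneg (sq_nonneg k) (sq_nonneg (Real.sin θ))])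
  have hc : Continuous fun θ : ℝ => 1 / √(1 - k ^ 2 * Real.sin θ ^ 2) :=
    continuous_const.div (by fun_prop) fun θ => (Real.sqrt_pos.2 (hpos θ)).ne'
  have hgrow : ∀ a b : ℝ, a ≤ b → b - a ≤ ellipticF k b - ellipticF k a := fun a b hab => by
    have h1 : ellipticF k b - ellipticF k a
        = ∫ θ in a..b, 1 / √(1 - k ^ 2 * Real.sin θ ^ 2) :=
      intervalIntegral.integral_interval_sub_left (hc.intervalIntegrable _ _)
        (hc.intervalIntegrable _ _)
    have h3 : IntervalIntegrable (fun _ : ℝ => (1 : ℝ)) MeasureTheory.volume a b :=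
      continuous_const.intervalIntegrable a b
    have h2 := intervalIntegral.integral_mono_on hab h3
      (hc.intervalIntegrable a b) fun θ _ => hle θ
    rw [h1]
    simpa using h2
  have h0 : ellipticF k 0 = 0 := by simp [ellipticF]
  have hcont : Continuous (ellipticF k) := by
    unfold ellipticF
    exact intervalIntegral.continuous_primitive (fun a b => hc.intervalIntegrable a b) 0
  refine ⟨StrictMono.injective fun a b hab => ?_, fun y => ?_⟩
  · linarith [hgrow a b hab.le]
  · have hmem : y ∈ Set.Icc (ellipticF k (-|y|)) (ellipticF k |y|) :=
      ⟨by linarith [hgrow (-|y|) 0 (by simp), neg_abs_le y],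
        by linarith [hgrow 0 |y| (abs_nonneg y), le_abs_self y]⟩
    obtain ⟨x, -, hx⟩ := intermediate_value_Icc (a := -|y|) (b := |y|)
      (by linarith [abs_nonneg y]) hcont.continuousOn hmem
    exact ⟨x, hx⟩

/-! ### Ring flowers and the discrete ring equations

A flower consists of five rings; index `0` is the central ring, the others are its neighbours.
Inner radii carry a sign, which is the orientation of the ring. -/

/-- The left hand side of the spherical ring equation
`∏ₖ sn((β - βₖ + iK')/2) / sn((β + βₖ + iK')/2) = 1` at a vertex with variable `β 0` and
neighbouring variables `β 1, …, β 4`. -/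
def sphericalProd (q : ℝ) (β : Fin 5 → ℝ) : ℂ :=
  ∏ k : Fin 4,
    csn q (((β 0 : ℂ) - (β k.succ : ℂ) + Complex.I * (ellipticK' q : ℂ)) / 2) /
      csn q (((β 0 : ℂ) + (β k.succ : ℂ) + Complex.I * (ellipticK' q : ℂ)) / 2)

/-- The left hand side of the hyperbolic ring equation
`∏ₖ sn((γ - γₖ + iK')/2) / sn((γ + γₖ - iK')/2) = 1`. -/
def hyperbolicProd (q : ℝ) (γ : Fin 5 → ℝ) : ℂ :=
  ∏ k : Fin 4,
    csn q (((γ 0 : ℂ) - (γ k.succ : ℂ) + Complex.I * (ellipticK' q : ℂ)) / 2) /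
      csn q (((γ 0 : ℂ) + (γ k.succ : ℂ) - Complex.I * (ellipticK' q : ℂ)) / 2)

/-- `β` is the uniformizing variable of spherical rings (with outer radius at most `π/2`) of
inner radius `r`: `β ∈ [0, 2K]`, `cos r = sn β`, `sin r = cn β`. -/
def IsSphericalVariable (q r β : ℝ) : Prop :=
  β ∈ Set.Icc 0 (2 * ellipticK q) ∧ Real.cos r = sn q β ∧ Real.sin r = cn q β

/-- `γ` is the uniformizing variable of hyperbolic rings of inner radius `r`:
`γ ∈ (0, 2K)`, `sinh r = cn γ / sn γ`. (The end points belong to infinite radii.) -/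
def IsHyperbolicVariable (q r γ : ℝ) : Prop :=
  γ ∈ Set.Ioo 0 (2 * ellipticK q) ∧ Real.sinh r = cn q γ / sn q γ

/-- The opening angle `θ = φ + ψ` at the centre of a spherical ring with radii `(r, R)` of the
quadrilateral spanned with an orthogonal ring with radii `(r', R')`, where
`φ = arctan (tan R' / sin r)` and `ψ = arctan (tan r' / sin R)`.
(`φ` is written as an argument in order to have the limit value `π/2` at `r = 0`.) -/
def sphericalAngle (r R r' R' : ℝ) : ℝ :=
  Complex.arg ⟨Real.sin r, Real.tan R'⟩ - (if r < 0 then Real.pi else 0) +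
    Real.arctan (Real.tan r' / Real.sin R)

/-- The hyperbolic opening angle, `φ = arctan (tanh R' / sinh r)`,
`ψ = arctan (tanh r' / sinh R)`. -/
def hyperbolicAngle (r R r' R' : ℝ) : ℝ :=
  Complex.arg ⟨Real.sinh r, Real.tanh R'⟩ - (if r < 0 then Real.pi else 0) +
    Real.arctan (Real.tanh r' / Real.sinh R)

/-- Five spherical rings form a ring flower up to the errors `δ₁`, `δ₂`: each neighbour
intersects the central ring orthogonally (`cos R cos rₖ = cos r cos Rₖ`, error `δ₁`), and the
opening angles at the centre close up to a full turn in the sense of the orientation of the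
central ring (error `δ₂`). -/
def IsSphericalFlowerUpTo (r R : Fin 5 → ℝ) (δ₁ δ₂ : ℝ) : Prop :=
  (∀ j, |r j| < R j ∧ R j < Real.pi / 2) ∧
  (∀ k : Fin 4, |Real.cos (R 0) * Real.cos (r k.succ) -
      Real.cos (r 0) * Real.cos (R k.succ)| ≤ δ₁) ∧
  |(∑ k : Fin 4, sphericalAngle (r 0) (R 0) (r k.succ) (R k.succ)) -
      (if r 0 < 0 then -(2 * Real.pi) else 2 * Real.pi)| ≤ δ₂

/-- The hyperbolic analogue, with `cosh R cosh rₖ = cosh r cosh Rₖ`. -/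
def IsHyperbolicFlowerUpTo (r R : Fin 5 → ℝ) (δ₁ δ₂ : ℝ) : Prop :=
  (∀ j, |r j| < R j) ∧
  (∀ k : Fin 4, |Real.cosh (R 0) * Real.cosh (r k.succ) -
      Real.cosh (r 0) * Real.cosh (R k.succ)| ≤ δ₁) ∧
  |(∑ k : Fin 4, hyperbolicAngle (r 0) (R 0) (r k.succ) (R k.succ)) -
      (if r 0 < 0 then -(2 * Real.pi) else 2 * Real.pi)| ≤ δ₂

/-- The points `(x,y)`, `(x±ε,y)`, `(x,y±ε)`. -/
def stencil (ε : ℝ) (p : EuclideanSpace ℝ (Fin 2)) : Fin 5 → EuclideanSpace ℝ (Fin 2) :=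
  ![p, p + !₂[ε, 0], p - !₂[ε, 0], p + !₂[0, ε], p - !₂[0, ε]]

end RingPattern

end

open Real

namespace RingPattern

open Filter Topology Asymptotics

/-! On the lines Im z = ±K'/2 the function sn of modulus q has constant absolute value q^(-1/2), so
the factors of the ring products are unimodular and only phases matter. Write β = K - w_0, β_k = K -
w_k and f = sn/(cn dn). A numerator has phase π/2 - arctan((1+q) f((w_k - w_0)/2)), a denominator
±arctan((1-q) f((w_0 + w_k)/2)); the minus sign is the hyperbolic case, where the denominator lies
on the conjugate line. Since i^4 = 1, the product is exp(-iΘ), with Θ a sum of four terms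
arctan((1+q) f) ± arctan((1-q) f) (`sphericalProd_eq_exp`, `hyperbolicProd_eq_exp`).

As q → 1, sn, cn, dn degenerate to tanh, sech, sech and f(x) to sinh(2x)/2; the substitution am =
arctan(sinh y) bounds the error (`exists_ellipticF_arctan_eq`). As 1+q ≈ 2 and 1-q ≈ ε²/2, this
gives Θ = Σ(w_k - w_0) ± ε² sinh(2w_0) + O(ε³), hence the expansion of the products
(`ringProd_sub_isBigO`). Taylor's formula on the stencil turns the sum into ε²Δu.

For radii ε sinh v, ε cosh v the variable K - β is an explicit function of v with derivative 1 +
O(ε²). Passing from v to K - β therefore changes the differences between neighbours only by O(ε³),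
and the differential equation still cancels the leading term (`shift_expansion`).

For the flowers, R² = r² + ε². The orthogonality defect is, up to O(ε⁶), antisymmetric in r² and
r_k² and carries a factor ε², so it is a multiple of ε²(r² - r_k²) = O(ε⁵). In the angle sum the
constants π/2 produce ±2π, and each remaining difference of arctangents equals (v_k - v) + σ ε²
sinh(2v)/4 + O(ε³), with σ = 1 (spherical) or σ = -1 (hyperbolic), so the same equation closes the
flower (`angle_isBigO`).

Uniformity is encoded by filters: estimates hold along a filter on a parameter type on which ε tends
to 0 from above, and the other parameters enter through principal filters. -/

/-! ### The elliptic integral, its symmetries and the real Jacobi functions. -/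

theorem one_sub_sq_mul_sin_sq_pos {k : ℝ} (hk : k ^ 2 < 1) (θ : ℝ) :
    0 < 1 - k ^ 2 * sin θ ^ 2 := by
  nlinarith [sin_sq_le_one θ, sq_nonneg k, sq_nonneg (sin θ)]

theorem hasDerivAt_ellipticF {k : ℝ} (hk : k ^ 2 < 1) (φ : ℝ) :
    HasDerivAt (ellipticF k) (1 / √(1 - k ^ 2 * sin φ ^ 2)) φ := by
  have hc : Continuous fun θ : ℝ => 1 / √(1 - k ^ 2 * sin θ ^ 2) :=
    continuous_const.div (by fun_prop) fun θ => (sqrt_pos.2 (one_sub_sq_mul_sin_sq_pos hk θ)).ne'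
  exact intervalIntegral.integral_hasDerivAt_right (hc.intervalIntegrable _ _)
    hc.stronglyMeasurable.stronglyMeasurableAtFilter hc.continuousAt

theorem ellipticF_zero (k : ℝ) : ellipticF k 0 = 0 := by simp [ellipticF]

theorem strictMono_ellipticF {k : ℝ} (hk : k ^ 2 < 1) : StrictMono (ellipticF k) :=
  strictMono_of_hasDerivAt_pos (fun φ => hasDerivAt_ellipticF hk φ) fun φ =>
    one_div_pos.2 (sqrt_pos.2 (one_sub_sq_mul_sin_sq_pos hk φ))

theorem am_ellipticF {k : ℝ} (hk : k ^ 2 < 1) (φ : ℝ) : am k (ellipticF k φ) = φ :=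
  Function.leftInverse_invFun (ellipticF_bijective hk).1 φ

theorem ellipticF_am {k : ℝ} (hk : k ^ 2 < 1) (x : ℝ) : ellipticF k (am k x) = x :=
  Function.rightInverse_invFun (ellipticF_bijective hk).2 x

theorem ellipticF_neg (k φ : ℝ) : ellipticF k (-φ) = -ellipticF k φ := by
  have h := intervalIntegral.integral_comp_neg (a := 0) (b := φ)
    (fun θ : ℝ => 1 / √(1 - k ^ 2 * sin θ ^ 2))
  simp only [sin_neg, neg_sq, neg_zero] at h
  rw [ellipticF, ellipticF, h, intervalIntegral.integral_symm]

theorem am_neg {k : ℝ} (hk : k ^ 2 < 1) (x : ℝ) : am k (-x) = -am k x := by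
  apply (ellipticF_bijective hk).1
  rw [ellipticF_am hk, ellipticF_neg, ellipticF_am hk]

/-- The integrand is symmetric about π/2, so the values of F at mirror points have a constant sum.
-/
theorem ellipticF_pi {k : ℝ} (hk : k ^ 2 < 1) : ellipticF k π = 2 * ellipticK k := by
  have hd : ∀ x : ℝ, HasDerivAt (fun x => ellipticF k (π / 2 + x) + ellipticF k (π / 2 - x)) 0 x := by
    intro x
    have h1 := (hasDerivAt_ellipticF hk (π / 2 + x)).comp x ((hasDerivAt_id x).const_add (π / 2))
    have h2 := (hasDerivAt_ellipticF hk (π / 2 - x)).comp x ((hasDerivAt_id x).const_sub (π / 2))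
    have h3 : sin (π / 2 + x) = sin (π / 2 - x) := by
      rw [sin_pi_div_two_sub, add_comm, sin_add_pi_div_two]
    refine (h1.add h2).congr_deriv ?_
    rw [h3]; ring
  have h := is_const_of_deriv_eq_zero (fun x => (hd x).differentiableAt) (fun x => (hd x).deriv)
    (π / 2) 0
  simp only [add_halves, sub_self, ellipticF_zero, add_zero, sub_zero] at h
  rw [h, ellipticK]; ring

/-- Reflection at half the quarter period, in the variable `s = tan (am x)`. -/
theorem ellipticF_arctan_add {k k' : ℝ} (hk : k ^ 2 + k' ^ 2 = 1) (hk' : 0 < k') (s : ℝ) :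
    ellipticF k (arctan s) + ellipticF k (π / 2 - arctan (k' * s)) = ellipticK k := by
  have hk1 : k ^ 2 < 1 := by nlinarith
  have hd : ∀ s : ℝ, HasDerivAt
      (fun s => ellipticF k (arctan s) + ellipticF k (π / 2 - arctan (k' * s))) 0 s := by
    intro s
    have h1 := (hasDerivAt_ellipticF hk1 (arctan s)).comp s (hasDerivAt_arctan s)
    have h2 := (hasDerivAt_ellipticF hk1 (π / 2 - arctan (k' * s))).comp s
      ((((hasDerivAt_id s).const_mul k').arctan).const_sub (π / 2))
    refine (h1.add h2).congr_deriv ?_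
    have e0 : 0 < 1 + s ^ 2 := by positivity
    have e1 : 0 < 1 + (k' * s) ^ 2 := by positivity
    -- In the variable s both radicands are quotients built from 1 + s² and 1 + (k's)², and the two
    -- derivatives cancel.
    have e2 : 1 - k ^ 2 * sin (arctan s) ^ 2 = (1 + (k' * s) ^ 2) / (1 + s ^ 2) := by
      rw [sin_sq_arctan]
      field_simp
      linear_combination (-s ^ 2) * hk
    have e3 : 1 - k ^ 2 * sin (π / 2 - arctan (k' * s)) ^ 2
        = k' ^ 2 * (1 + s ^ 2) / (1 + (k' * s) ^ 2) := by
      rw [sin_pi_div_two_sub, cos_sq_arctan]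
      field_simp
      linear_combination (-1 : ℝ) * hk
    rw [id_eq, e2, e3, sqrt_div e1.le, sqrt_div (by positivity), sqrt_mul (sq_nonneg _),
      sqrt_sq hk'.le]
    have f0 := sqrt_pos.2 e0
    have f1 := sqrt_pos.2 e1
    have g0 := sq_sqrt e0.le
    have g1 := sq_sqrt e1.le
    set A := √(1 + s ^ 2)
    set B := √(1 + (k' * s) ^ 2)
    rw [← g0, ← g1]
    field_simp
    ring
  have h := is_const_of_deriv_eq_zero (fun x => (hd x).differentiableAt) (fun x => (hd x).deriv) s 0
  simpa [ellipticF_zero, ellipticK] using h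

section arctan_values

variable {k k' : ℝ} (hk : k ^ 2 + k' ^ 2 = 1) (hk' : 0 < k') (s : ℝ)
include hk hk'

theorem sn_ellipticF_arctan : sn k (ellipticF k (arctan s)) = s / √(1 + s ^ 2) := by
  rw [sn, am_ellipticF (by nlinarith), sin_arctan]

theorem cn_ellipticF_arctan : cn k (ellipticF k (arctan s)) = 1 / √(1 + s ^ 2) := by
  rw [cn, am_ellipticF (by nlinarith), cos_arctan]

theorem dn_ellipticF_arctan :
    dn k (ellipticF k (arctan s)) = √(1 + (k' * s) ^ 2) / √(1 + s ^ 2) := by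
  have e0 : 0 < 1 + s ^ 2 := by positivity
  rw [dn, sn_ellipticF_arctan hk hk', ← sqrt_div (by positivity), div_pow, sq_sqrt e0.le]
  congr 1
  field_simp
  linear_combination (-s ^ 2) * hk

theorem ellipticK_sub_ellipticF_arctan :
    ellipticK k - ellipticF k (arctan s) = ellipticF k (π / 2 - arctan (k' * s)) := by
  linarith [ellipticF_arctan_add hk hk' s]

theorem sn_ellipticK_sub :
    sn k (ellipticK k - ellipticF k (arctan s)) = 1 / √(1 + (k' * s) ^ 2) := by
  rw [ellipticK_sub_ellipticF_arctan hk hk', sn, am_ellipticF (by nlinarith), sin_pi_div_two_sub,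
    cos_arctan]

theorem cn_ellipticK_sub :
    cn k (ellipticK k - ellipticF k (arctan s)) = k' * s / √(1 + (k' * s) ^ 2) := by
  rw [ellipticK_sub_ellipticF_arctan hk hk', cn, am_ellipticF (by nlinarith), cos_pi_div_two_sub,
    sin_arctan]

theorem dn_ellipticK_sub :
    dn k (ellipticK k - ellipticF k (arctan s)) = k' * √(1 + s ^ 2) / √(1 + (k' * s) ^ 2) := by
  have e1 : 0 < 1 + (k' * s) ^ 2 := by positivity
  rw [dn, sn_ellipticK_sub hk hk', div_pow, sq_sqrt e1.le]
  nth_rewrite 2 [← sqrt_sq hk'.le]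
  rw [← sqrt_mul (sq_nonneg _), ← sqrt_div (by positivity)]
  congr 1
  field_simp
  linear_combination (-1 : ℝ) * hk

end arctan_values

/-! ### Modulus and phase of sn on the lines Im z = ±K'/2. -/

/-- At s = 1/√k' the angles arctan s and arctan(k's) are complementary, so both terms of the
reflection formula coincide. -/
theorem ellipticK_div_two {k k' : ℝ} (hk : k ^ 2 + k' ^ 2 = 1) (hk' : 0 < k') :
    ellipticK k / 2 = ellipticF k (arctan (√k')⁻¹) := by
  have h := ellipticF_arctan_add hk hk' (√k')⁻¹
  have h1 : k' * (√k')⁻¹ = √k' := by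
    rw [← div_eq_mul_inv, div_sqrt]
  rw [h1, ← arctan_inv_of_pos (sqrt_pos.2 hk')] at h
  linarith

/-- The imaginary part K'/2 is a half quarter period of modulus k', whose complementary modulus is
k, so it corresponds to s = 1/√k. -/
theorem csn_mk_half {k k' : ℝ} (hk : k ^ 2 + k' ^ 2 = 1) (hk0 : 0 < k) (hk' : 0 < k') (x : ℝ) :
    csn k ⟨x, ellipticK' k / 2⟩ = ((√k)⁻¹ : ℝ) *
      (((1 + k) * sn k x : ℝ) + (cn k x * dn k x : ℝ) * Complex.I) /
        ((1 + k * sn k x ^ 2 : ℝ) : ℂ) := by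
  have hc : complMod k = k' := by
    rw [complMod, show 1 - k ^ 2 = k' ^ 2 by linarith, sqrt_sq hk'.le]
  have hk2 : k' ^ 2 + k ^ 2 = 1 := by linarith
  have hr := sqrt_pos.2 hk0
  have hr2 := sq_sqrt hk0.le
  have hx : dn k x ^ 2 = 1 - k ^ 2 * sn k x ^ 2 :=
    sq_sqrt (one_sub_sq_mul_sin_sq_pos (by nlinarith) _).le
  have hA : √(1 + (√k)⁻¹ ^ 2) ^ 2 = 1 + (√k)⁻¹ ^ 2 := sq_sqrt (by positivity)
  have hA0 : 0 < √(1 + (√k)⁻¹ ^ 2) := sqrt_pos.2 (by positivity)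
  have hd : √(1 + (k * (√k)⁻¹) ^ 2) = √k * √(1 + (√k)⁻¹ ^ 2) := by
    rw [← sqrt_mul hk0.le]
    congr 1
    rw [mul_pow, inv_pow, hr2]
    field_simp
    exact add_comm _ _
  unfold csn
  simp only
  rw [hc, ellipticK', hc, ellipticK_div_two hk2 hk0, sn_ellipticF_arctan hk2 hk0,
    cn_ellipticF_arctan hk2 hk0, dn_ellipticF_arctan hk2 hk0, hd, hx]
  set A := √(1 + (√k)⁻¹ ^ 2)
  set r := √k
  have hA2 : A ^ 2 = (1 + k) / k := by rw [hA, inv_pow, hr2]; field_simp; exact add_comm _ _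
  have e1 : r * A / A = r := by field_simp
  have e2 : cn k x * dn k x * (r⁻¹ / A) * (1 / A) = cn k x * dn k x * (r / (1 + k)) := by
    have : r⁻¹ / A * (1 / A) = r / (1 + k) := by
      rw [div_mul_div_comm, ← sq, hA2, ← hr2]; field_simp
    rw [mul_assoc, this]
  have e3 : 1 - (1 - k ^ 2 * sn k x ^ 2) * (r⁻¹ / A) ^ 2 = r ^ 2 * (1 + k * sn k x ^ 2) / (1 + k) := by
    rw [div_pow, hA2, inv_pow, hr2]; field_simp; ring
  rw [e1, e2, e3]
  have hk3 : (1 + k : ℂ) ≠ 0 := by exact_mod_cast (by positivity : (1 + k) ≠ 0)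
  have hr3 : (r : ℂ) ≠ 0 := by exact_mod_cast hr.ne'
  have hk4 : (1 + k * sn k x ^ 2 : ℂ) ≠ 0 := by
    exact_mod_cast (by positivity : (1 + k * sn k x ^ 2) ≠ 0)
  push_cast
  field_simp

theorem csn_mk_neg {k : ℝ} (hk0 : k ≠ 0) (hk : k ^ 2 < 1) (x y : ℝ) :
    csn k ⟨x, -y⟩ = (starRingEnd ℂ) (csn k ⟨x, y⟩) := by
  have hc : complMod k ^ 2 < 1 := by
    rw [complMod, sq_sqrt (by linarith)]
    have := sq_pos_of_ne_zero hk0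
    linarith
  simp only [csn, dn, sn, cn, am_neg hc, sin_neg, cos_neg, neg_sq, map_div₀, map_add, map_mul,
    Complex.conj_ofReal, Complex.conj_I]
  push_cast
  ring

theorem exp_arctan_mul_I (t : ℝ) :
    Complex.exp (arctan t * Complex.I) = (1 + t * Complex.I) / (√(1 + t ^ 2) : ℝ) := by
  rw [Complex.exp_mul_I, ← Complex.ofReal_cos, ← Complex.ofReal_sin, cos_arctan, sin_arctan]
  push_cast
  ring

/-- Positivity of a puts the point in the right half-plane, where arctan(b/a) is the argument. -/
theorem add_mul_I_div_eq_exp {a b c : ℝ} (ha : 0 < a) (hc : 0 < c) (h : a ^ 2 + b ^ 2 = c ^ 2) :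
    (a + b * Complex.I) / c = Complex.exp (arctan (b / a) * Complex.I) := by
  have h1 : √(1 + (b / a) ^ 2) = c / a := by
    rw [← sqrt_sq (by positivity : 0 ≤ c / a)]
    congr 1
    field_simp
    exact h
  have ha' : (a : ℂ) ≠ 0 := by exact_mod_cast ha.ne'
  have hc' : (c : ℂ) ≠ 0 := by exact_mod_cast hc.ne'
  rw [exp_arctan_mul_I, h1]
  push_cast
  field_simp

/-- The function `sn / (cn dn)`, which governs the phase of `sn` on the lines
`Im z = ± K' / 2`. -/
noncomputable def phaseRatio (k x : ℝ) : ℝ := sn k x / (cn k x * dn k x)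

theorem sn_sq_add_cn_sq (k x : ℝ) : sn k x ^ 2 + cn k x ^ 2 = 1 := sin_sq_add_cos_sq _

section phase

variable {k k' : ℝ} (hk : k ^ 2 + k' ^ 2 = 1) (hk0 : 0 < k) (hk' : 0 < k') (s : ℝ)
include hk hk0 hk'

/-- The absolute value is constant because (1+k)² sn² + cn² dn² = (1 + k sn²)². The factor i is
split off since cn dn, the positive quantity here, is the imaginary part, whereas sn may vanish. -/
theorem csn_half_eq_exp :
    csn k ⟨ellipticF k (arctan s), ellipticK' k / 2⟩ = ((√k)⁻¹ : ℝ) * (Complex.I *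
      Complex.exp (-(arctan ((1 + k) * phaseRatio k (ellipticF k (arctan s))) : ℝ) *
        Complex.I)) := by
  rw [csn_mk_half hk hk0 hk', phaseRatio]
  have hs := sn_sq_add_cn_sq k (ellipticF k (arctan s))
  have hd : dn k (ellipticF k (arctan s)) ^ 2 = 1 - k ^ 2 * sn k (ellipticF k (arctan s)) ^ 2 :=
    sq_sqrt (one_sub_sq_mul_sin_sq_pos (by nlinarith) _).le
  have hc0 : 0 < cn k (ellipticF k (arctan s)) := by
    rw [cn_ellipticF_arctan hk hk']; positivity
  have hd0 : 0 < dn k (ellipticF k (arctan s)) := by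
    rw [dn_ellipticF_arctan hk hk']; positivity
  set S := sn k (ellipticF k (arctan s))
  set C := cn k (ellipticF k (arctan s))
  set D := dn k (ellipticF k (arctan s))
  have hCD := mul_pos hc0 hd0
  have h := add_mul_I_div_eq_exp (a := C * D) (b := -((1 + k) * S)) (c := 1 + k * S ^ 2) hCD
    (by positivity) (by rw [mul_pow, hd]; linear_combination (1 - k ^ 2 * S ^ 2) * hs)
  rw [neg_div, mul_div_assoc, arctan_neg, Complex.ofReal_neg, Complex.ofReal_neg (arctan _)] at h
  rw [← h]
  push_cast
  linear_combination (((√k : ℝ) : ℂ))⁻¹ * (1 + k) * S / (1 + k * S ^ 2) * Complex.I_sq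

/-- Near K it is the real part that is positive. The tangent of the phase acquires the factor
k'²/(1+k) = 1 - k, which is the source of the small coefficient ε²/2 of the sinh term. -/
theorem csn_ellipticK_sub_half_eq_exp :
    csn k ⟨ellipticK k - ellipticF k (arctan s), ellipticK' k / 2⟩ = ((√k)⁻¹ : ℝ) *
      Complex.exp ((arctan ((1 - k) * phaseRatio k (ellipticF k (arctan s))) : ℝ) *
        Complex.I) := by
  rw [csn_mk_half hk hk0 hk', phaseRatio]
  rw [sn_ellipticF_arctan hk hk', cn_ellipticF_arctan hk hk', dn_ellipticF_arctan hk hk',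
    sn_ellipticK_sub hk hk', cn_ellipticK_sub hk hk', dn_ellipticK_sub hk hk']
  have hA0 : 0 < √(1 + s ^ 2) := sqrt_pos.2 (by positivity)
  have hB0 : 0 < √(1 + (k' * s) ^ 2) := sqrt_pos.2 (by positivity)
  have hA := sq_sqrt (by positivity : 0 ≤ 1 + s ^ 2)
  have hB := sq_sqrt (by positivity : 0 ≤ 1 + (k' * s) ^ 2)
  set A := √(1 + s ^ 2)
  set B := √(1 + (k' * s) ^ 2)
  have hB2 : B ^ 2 = 1 + (1 - k ^ 2) * s ^ 2 := by rw [hB]; linear_combination s ^ 2 * hk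
  have h := add_mul_I_div_eq_exp (a := (1 + k) * (1 / B)) (b := k' * s / B * (k' * A / B))
    (c := 1 + k * (1 / B) ^ 2) (by positivity) (by positivity) (by
      have e : (k' * s / B * (k' * A / B)) ^ 2 = (k' ^ 2) ^ 2 * s ^ 2 * A ^ 2 / (B ^ 2) ^ 2 := by
        field_simp
      have e2 : (1 + k * (1 / B) ^ 2) ^ 2 = (B ^ 2 + k) ^ 2 / (B ^ 2) ^ 2 := by
        field_simp
      have e3 : ((1 + k) * (1 / B)) ^ 2 = (1 + k) ^ 2 * B ^ 2 / (B ^ 2) ^ 2 := by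
        field_simp
      rw [e, e2, e3, ← add_div, hA, hB2, show k' ^ 2 = 1 - k ^ 2 by linarith]
      congr 1
      ring)
  have e4 : k' * s / B * (k' * A / B) / ((1 + k) * (1 / B))
      = (1 - k) * (s / A / (1 / A * (B / A))) := by
    field_simp
    linear_combination s * hk
  rw [e4] at h
  rw [← h, mul_div_assoc]

end phase

/-- The phase of the numerator of a factor of the ring equations. -/
noncomputable def numPhase (k x : ℝ) : ℝ := arctan ((1 + k) * phaseRatio k x)

/-- The phase of the denominator of a factor of the ring equations. -/
noncomputable def denPhase (k x : ℝ) : ℝ := arctan ((1 - k) * phaseRatio k x)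

/-! ### The ring products as exponentials of phases. -/

section product

variable {k k' : ℝ} (hk : k ^ 2 + k' ^ 2 = 1) (hk0 : 0 < k) (hk' : 0 < k') (w : Fin 5 → ℝ)
  (hy : ∀ j : Fin 4, ∃ s, ellipticF k (arctan s) = (w j.succ - w 0) / 2)
  (hz : ∀ j : Fin 4, ∃ s, ellipticF k (arctan s) = (w 0 + w j.succ) / 2)
include hk hk0 hk' hy hz

/-- The absolute values q^(-1/2) cancel in each quotient and the four factors i multiply to 1. The
hypotheses `hy` and `hz` place the real arguments in (-K, K), the range of F ∘ arctan. -/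
theorem sphericalProd_eq_exp :
    sphericalProd k (fun j => ellipticK k - w j) = Complex.exp (-((∑ j : Fin 4,
      (numPhase k ((w j.succ - w 0) / 2) + denPhase k ((w 0 + w j.succ) / 2)) : ℝ) *
        Complex.I)) := by
  have hf : ∀ j : Fin 4,
      csn k ((((ellipticK k - w 0 : ℝ) : ℂ) - ((ellipticK k - w j.succ : ℝ) : ℂ) +
          Complex.I * (ellipticK' k : ℂ)) / 2) /
        csn k ((((ellipticK k - w 0 : ℝ) : ℂ) + ((ellipticK k - w j.succ : ℝ) : ℂ) +
          Complex.I * (ellipticK' k : ℂ)) / 2) =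
      Complex.I * Complex.exp (-((numPhase k ((w j.succ - w 0) / 2) +
        denPhase k ((w 0 + w j.succ) / 2) : ℝ) * Complex.I)) := by
    intro j
    obtain ⟨y, hy⟩ := hy j
    obtain ⟨z, hz⟩ := hz j
    have e1 : (((ellipticK k - w 0 : ℝ) : ℂ) - ((ellipticK k - w j.succ : ℝ) : ℂ) +
        Complex.I * (ellipticK' k : ℂ)) / 2 = ⟨(w j.succ - w 0) / 2, ellipticK' k / 2⟩ := by
      apply Complex.ext <;> simp
    have e2 : (((ellipticK k - w 0 : ℝ) : ℂ) + ((ellipticK k - w j.succ : ℝ) : ℂ) +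
        Complex.I * (ellipticK' k : ℂ)) / 2
          = ⟨ellipticK k - (w 0 + w j.succ) / 2, ellipticK' k / 2⟩ := by
      apply Complex.ext <;> simp
      ring
    have hr : (((√k)⁻¹ : ℝ) : ℂ) ≠ 0 := by
      exact_mod_cast (inv_pos.2 (sqrt_pos.2 hk0)).ne'
    rw [e1, e2, ← hy, ← hz, csn_half_eq_exp hk hk0 hk', csn_ellipticK_sub_half_eq_exp hk hk0 hk',
      mul_div_mul_left _ _ hr, mul_div_assoc, ← Complex.exp_sub, numPhase, denPhase]
    congr 2
    push_cast
    ring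
  rw [sphericalProd, Finset.prod_congr rfl fun j _ => hf j, Finset.prod_mul_distrib,
    ← Complex.exp_sum]
  simp only [Finset.prod_const, Finset.card_univ, Fintype.card_fin, Complex.I_pow_four, one_mul]
  congr 1
  push_cast
  rw [Finset.sum_mul, Finset.sum_neg_distrib]

theorem hyperbolicProd_eq_exp :
    hyperbolicProd k (fun j => ellipticK k - w j) = Complex.exp (-((∑ j : Fin 4,
      (numPhase k ((w j.succ - w 0) / 2) - denPhase k ((w 0 + w j.succ) / 2)) : ℝ) *
        Complex.I)) := by
  have hf : ∀ j : Fin 4,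
      csn k ((((ellipticK k - w 0 : ℝ) : ℂ) - ((ellipticK k - w j.succ : ℝ) : ℂ) +
          Complex.I * (ellipticK' k : ℂ)) / 2) /
        csn k ((((ellipticK k - w 0 : ℝ) : ℂ) + ((ellipticK k - w j.succ : ℝ) : ℂ) -
          Complex.I * (ellipticK' k : ℂ)) / 2) =
      Complex.I * Complex.exp (-((numPhase k ((w j.succ - w 0) / 2) -
        denPhase k ((w 0 + w j.succ) / 2) : ℝ) * Complex.I)) := by
    intro j
    obtain ⟨y, hy⟩ := hy j
    obtain ⟨z, hz⟩ := hz j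
    have e1 : (((ellipticK k - w 0 : ℝ) : ℂ) - ((ellipticK k - w j.succ : ℝ) : ℂ) +
        Complex.I * (ellipticK' k : ℂ)) / 2 = ⟨(w j.succ - w 0) / 2, ellipticK' k / 2⟩ := by
      apply Complex.ext <;> simp
    have e2 : (((ellipticK k - w 0 : ℝ) : ℂ) + ((ellipticK k - w j.succ : ℝ) : ℂ) -
        Complex.I * (ellipticK' k : ℂ)) / 2
          = ⟨ellipticK k - (w 0 + w j.succ) / 2, -(ellipticK' k / 2)⟩ := by
      apply Complex.ext <;> simp
      · ring
      · ring
    have hr : (((√k)⁻¹ : ℝ) : ℂ) ≠ 0 := by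
      exact_mod_cast (inv_pos.2 (sqrt_pos.2 hk0)).ne'
    -- The denominator lies on Im z = -K'/2; conjugation reverses its phase and thereby the sign of
    -- `denPhase`.
    rw [e1, e2, ← hy, ← hz, csn_mk_neg hk0.ne' (by nlinarith), csn_half_eq_exp hk hk0 hk',
      csn_ellipticK_sub_half_eq_exp hk hk0 hk', map_mul, Complex.conj_ofReal,
      ← Complex.exp_conj, map_mul, Complex.conj_ofReal, Complex.conj_I,
      mul_div_mul_left _ _ hr, mul_div_assoc, ← Complex.exp_sub, numPhase, denPhase]
    congr 2
    push_cast
    ring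
  rw [hyperbolicProd, Finset.prod_congr rfl fun j _ => hf j, Finset.prod_mul_distrib,
    ← Complex.exp_sum]
  simp only [Finset.prod_const, Finset.card_univ, Fintype.card_fin, Complex.I_pow_four, one_mul]
  congr 1
  push_cast
  rw [Finset.sum_mul, Finset.sum_neg_distrib]

end product

/-! ### Degeneration of the Jacobi functions as the modulus tends to 1. -/

theorem abs_sub_le_of_hasDerivAt {f f' : ℝ → ℝ} {N C : ℝ}
    (hf : ∀ x, |x| ≤ N → HasDerivAt f (f' x) x) (hC : ∀ x, |x| ≤ N → |f' x| ≤ C)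
    {a b : ℝ} (ha : |a| ≤ N) (hb : |b| ≤ N) : |f a - f b| ≤ C * |a - b| := by
  have := (convex_Icc (-N) N).norm_image_sub_le_of_norm_hasDerivWithin_le (f := f) (f' := f')
    (fun x hx => (hf x (abs_le.2 hx)).hasDerivWithinAt) (fun x hx => hC x (abs_le.2 hx))
    (abs_le.1 hb) (abs_le.1 ha)
  simpa using this

theorem abs_sinh_sub_sinh_le {N a b : ℝ} (ha : |a| ≤ N) (hb : |b| ≤ N) :
    |sinh a - sinh b| ≤ cosh N * |a - b| :=
  abs_sub_le_of_hasDerivAt (fun x _ => hasDerivAt_sinh x) (fun x hx => by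
    rw [abs_of_pos (cosh_pos x), cosh_le_cosh]
    exact hx.trans (le_abs_self N)) ha hb

theorem one_sub_inv_sqrt_nonneg {t : ℝ} (ht : 0 ≤ t) : 0 ≤ 1 - 1 / √(1 + t) := by
  rw [sub_nonneg, div_le_one (sqrt_pos.2 (by positivity))]
  exact one_le_sqrt.2 (by linarith)

theorem one_sub_inv_sqrt_le {t : ℝ} (ht : 0 ≤ t) : 1 - 1 / √(1 + t) ≤ t := by
  have h1 : 1 ≤ √(1 + t) := one_le_sqrt.2 (by linarith)
  have h2 : √(1 + t) ^ 2 = 1 + t := sq_sqrt (by positivity)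
  have h3 : √(1 + t) ≤ 1 + t := by nlinarith
  rw [sub_le_comm, le_div_iff₀ (by positivity)]
  nlinarith

/-- For k = 1 the map y ↦ F(arctan(sinh y)) is the identity; in general its derivative is 1 + O(k'²)
for bounded y, which makes y the natural comparison variable. -/
theorem hasDerivAt_ellipticF_arctan_sinh {k k' : ℝ} (hk : k ^ 2 + k' ^ 2 = 1) (hk' : 0 < k')
    (y : ℝ) : HasDerivAt (fun y => ellipticF k (arctan (sinh y)))
      (1 / √(1 + (k' * sinh y) ^ 2)) y := by
  have hk1 : k ^ 2 < 1 := by nlinarith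
  refine ((hasDerivAt_ellipticF hk1 _).comp y (hasDerivAt_sinh y).arctan).congr_deriv ?_
  have e1 : 0 < 1 + (k' * sinh y) ^ 2 := by positivity
  have e2 : 1 - k ^ 2 * sin (arctan (sinh y)) ^ 2
      = (1 + (k' * sinh y) ^ 2) / cosh y ^ 2 := by
    rw [sin_sq_arctan, ← cosh_sq' y]
    have := (cosh_pos y).ne'
    field_simp
    rw [cosh_sq y]
    linear_combination (-sinh y ^ 2) * hk
  rw [e2, sqrt_div e1.le, sqrt_sq (cosh_pos y).le, ← cosh_sq' y]
  have := (cosh_pos y).ne'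
  have := (sqrt_pos.2 e1).ne'
  field_simp

theorem phaseRatio_ellipticF_arctan_sinh {k k' : ℝ} (hk : k ^ 2 + k' ^ 2 = 1) (hk' : 0 < k')
    (y : ℝ) : phaseRatio k (ellipticF k (arctan (sinh y)))
      = sinh (2 * y) / 2 * (1 / √(1 + (k' * sinh y) ^ 2)) := by
  have e1 : 0 < 1 + (k' * sinh y) ^ 2 := by positivity
  rw [phaseRatio, sn_ellipticF_arctan hk hk', cn_ellipticF_arctan hk hk',
    dn_ellipticF_arctan hk hk', ← cosh_sq' y, sqrt_sq (cosh_pos y).le, sinh_two_mul]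
  have := (cosh_pos y).ne'
  have := (sqrt_pos.2 e1).ne'
  field_simp

theorem sq_sqrt_one_sub_add {ε : ℝ} (h0 : 0 < ε) (h1 : ε < 1) : √(1 - ε ^ 2) ^ 2 + ε ^ 2 = 1 := by
  rw [sq_sqrt (by nlinarith)]; ring

/-- K tends to infinity as ε → 0, so bounded x eventually lie in (-K, K). The factor |x| in the
error is needed: for x = O(ε) it improves the error to O(ε³). -/
theorem exists_ellipticF_arctan_eq (M : ℝ) : ∃ C : ℝ, ∀ᶠ ε in 𝓝[>] (0 : ℝ), ∀ x : ℝ, |x| ≤ M →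
    (∃ s, ellipticF √(1 - ε ^ 2) (arctan s) = x) ∧
      |phaseRatio √(1 - ε ^ 2) x - sinh (2 * x) / 2| ≤ C * (ε ^ 2 * |x|) := by
  set N := |M| + 1 with hN
  have hN0 : 0 < N := by positivity
  set T := sinh N ^ 2 with hT
  have hT0 : 0 ≤ T := sq_nonneg _
  refine ⟨cosh (2 * N) * (4 * T), ?_⟩
  -- The smallness ε²T·2N < 1 keeps the displacement |G y - y| at most 1/2 for |y| ≤ N, less than
  -- the margin N - |M| = 1, so the image of [-N, N] covers [-|M|, |M|].
  have ht : Tendsto (fun ε : ℝ => ε ^ 2 * (T * (2 * N))) (𝓝[>] 0) (𝓝 0) := by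
    have : Tendsto (fun ε : ℝ => ε ^ 2 * (T * (2 * N))) (𝓝 0) (𝓝 (0 ^ 2 * (T * (2 * N)))) :=
      Continuous.tendsto (by fun_prop) 0
    simpa using this.mono_left nhdsWithin_le_nhds
  filter_upwards [ht.eventually_lt_const one_pos, self_mem_nhdsWithin,
    Ioo_mem_nhdsGT (one_pos : (0 : ℝ) < 1)] with ε hε h0 h1 x hx
  have h0 : 0 < ε := h0
  have hk := sq_sqrt_one_sub_add h0 h1.2
  set k := √(1 - ε ^ 2)
  set G := fun y => ellipticF k (arctan (sinh y)) with hG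
  have hG0 : G 0 = 0 := by simp [hG, ellipticF_zero]
  have hS : ∀ y, |y| ≤ N → (ε * sinh y) ^ 2 ≤ ε ^ 2 * T := by
    intro y hy
    rw [mul_pow, hT]
    gcongr 1
    rw [sq_le_sq, abs_sinh, abs_sinh, sinh_le_sinh]
    exact hy.trans (le_abs_self N)
  have hinv : ∀ y, |y| ≤ N → |1 / √(1 + (ε * sinh y) ^ 2) - 1| ≤ ε ^ 2 * T := by
    intro y hy
    rw [abs_sub_comm, abs_of_nonneg (one_sub_inv_sqrt_nonneg (sq_nonneg _))]
    exact (one_sub_inv_sqrt_le (sq_nonneg _)).trans (hS y hy)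
  have hGy : ∀ y, |y| ≤ N → |G y - y| ≤ ε ^ 2 * T * |y| := by
    intro y hy
    have := abs_sub_le_of_hasDerivAt (f := fun y => G y - y) (N := N)
      (fun y _ => (hasDerivAt_ellipticF_arctan_sinh hk h0 y).sub (hasDerivAt_id y))
      hinv hy (b := 0) (by simpa using hN0.le)
    simpa [hG0] using this
  have hεT : ε ^ 2 * T * N ≤ 1 / 2 := by linarith
  have hεT' : ε ^ 2 * T ≤ 1 / 2 := by
    have : 1 ≤ N := by rw [hN]; linarith [abs_nonneg M]
    nlinarith [mul_nonneg (sq_nonneg ε) hT0]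
  have hcont : Continuous G := continuous_iff_continuousAt.2 fun y =>
    (hasDerivAt_ellipticF_arctan_sinh hk h0 y).continuousAt
  have hxM : |x| ≤ |M| := hx.trans (le_abs_self M)
  obtain ⟨y, hyN, hyx⟩ : ∃ y, |y| ≤ N ∧ G y = x := by
    have hmem : x ∈ Set.Icc (G (-N)) (G N) := by
      have h1 := hGy N (abs_of_pos hN0).le
      have h2 := hGy (-N) (by rw [abs_neg, abs_of_pos hN0])
      rw [abs_neg] at h2
      rw [abs_of_pos hN0, abs_le] at h1 h2
      rw [abs_le] at hxM
      constructor <;> linarith [h1.1, h2.2, hxM.1, hxM.2]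
    obtain ⟨y, hy, hyx⟩ := intermediate_value_Icc (by linarith) hcont.continuousOn hmem
    exact ⟨y, abs_le.2 hy, hyx⟩
  refine ⟨⟨sinh y, hyx⟩, ?_⟩
  have hd := hGy y hyN
  rw [hyx] at hd
  have hy2 : |y| ≤ 2 * |x| := by
    have := abs_sub_abs_le_abs_sub y x
    rw [abs_sub_comm] at this
    nlinarith [abs_nonneg y]
  have hxN : |x| ≤ N := by linarith
  rw [← hyx, phaseRatio_ellipticF_arctan_sinh hk h0]
  change |_ - sinh (2 * G y) / 2| ≤ cosh (2 * N) * (4 * T) * (ε ^ 2 * |G y|)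
  rw [hyx]
  have ha : ∀ z : ℝ, |z| ≤ N → |2 * z| ≤ 2 * N := fun z hz => by
    rw [abs_mul, abs_two]; linarith
  have hs1 := abs_sinh_sub_sinh_le (ha y hyN) (ha x hxN)
  have hs0 := abs_sinh_sub_sinh_le (ha y hyN) (b := 0) (by simpa using hN0.le)
  rw [sinh_zero, sub_zero, sub_zero, abs_mul, abs_two] at hs0
  rw [← mul_sub, abs_mul, abs_two, abs_sub_comm y x] at hs1
  -- The two errors, from the root and from replacing y by x, are each at most cosh(2N) ε²T|y|; with
  -- |y| ≤ 2|x| this gives the constant 4T cosh(2N).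
  have e : sinh (2 * y) / 2 * (1 / √(1 + (ε * sinh y) ^ 2)) - sinh (2 * x) / 2
      = sinh (2 * y) / 2 * (1 / √(1 + (ε * sinh y) ^ 2) - 1)
        + (sinh (2 * y) - sinh (2 * x)) / 2 := by ring
  rw [e]
  refine (abs_add_le _ _).trans ?_
  rw [abs_mul, abs_div, abs_div, abs_two]
  have hc := (cosh_pos (2 * N)).le
  have h3 : |sinh (2 * y)| / 2 * |1 / √(1 + (ε * sinh y) ^ 2) - 1|
      ≤ cosh (2 * N) * |y| * (ε ^ 2 * T) := by
    gcongr
    · linarith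
    · exact hinv y hyN
  have h4 : |sinh (2 * y) - sinh (2 * x)| / 2 ≤ cosh (2 * N) * (ε ^ 2 * T * |y|) := by
    have : cosh (2 * N) * |x - y| ≤ cosh (2 * N) * (ε ^ 2 * T * |y|) := by gcongr
    linarith
  have h5 : cosh (2 * N) * (ε ^ 2 * T) * |y| ≤ cosh (2 * N) * (ε ^ 2 * T) * (2 * |x|) := by
    gcongr
  linarith

/-! ### Taylor expansions at the origin -/

/-- Integrating an estimate of the derivative gains one order; all expansions at 0 below are built
by climbing this ladder. -/
theorem isBigO_pow_succ_of_hasDerivAt {f f' : ℝ → ℝ} {n : ℕ}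
    (hf : ∀ᶠ x in 𝓝 0, HasDerivAt f (f' x) x) (h0 : f 0 = 0)
    (hf' : f' =O[𝓝 0] fun x => x ^ n) : f =O[𝓝 0] fun x => x ^ (n + 1) := by
  obtain ⟨C, hC0, hC⟩ := hf'.exists_nonneg
  obtain ⟨δ, hδ, hb⟩ := Metric.eventually_nhds_iff.1 (hf.and hC.bound)
  refine IsBigO.of_bound C (Metric.eventually_nhds_iff.2 ⟨δ, hδ, fun x hx => ?_⟩)
  rw [Real.dist_eq, sub_zero] at hx
  have hδ' : ∀ y : ℝ, |y| ≤ |x| → dist y 0 < δ := fun y hy => by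
    rw [Real.dist_eq, sub_zero]; exact hy.trans_lt hx
  have h := abs_sub_le_of_hasDerivAt (f := f) (f' := f') (N := |x|) (C := C * |x| ^ n)
    (fun y hy => (hb (hδ' y hy)).1) (fun y hy => by
      have := (hb (hδ' y hy)).2
      rw [norm_eq_abs, norm_eq_abs, abs_pow] at this
      exact this.trans (by gcongr)) le_rfl (b := 0) (by simp)
  rw [h0, sub_zero, sub_zero] at h
  rw [norm_eq_abs, norm_eq_abs, abs_pow, pow_succ, ← mul_assoc]
  exact h

theorem isBigO_one_of_continuousAt {f : ℝ → ℝ} (hf : ContinuousAt f 0) :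
    f =O[𝓝 0] fun x => x ^ 0 := by
  simpa using hf.tendsto.isBigO_one ℝ

theorem sin_isBigO : sin =O[𝓝 0] fun x => x ^ 1 :=
  isBigO_pow_succ_of_hasDerivAt (.of_forall hasDerivAt_sin) sin_zero
    (isBigO_one_of_continuousAt continuous_cos.continuousAt)

theorem cos_sub_isBigO_two : (fun x => cos x - 1) =O[𝓝 0] fun x => x ^ 2 :=
  isBigO_pow_succ_of_hasDerivAt (.of_forall fun x => (hasDerivAt_cos x).sub_const 1) (by simp)
    sin_isBigO.neg_left

theorem sin_sub_isBigO_three : (fun x => sin x - x) =O[𝓝 0] fun x => x ^ 3 :=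
  isBigO_pow_succ_of_hasDerivAt (.of_forall fun x => (hasDerivAt_sin x).sub (hasDerivAt_id x))
    (by simp) cos_sub_isBigO_two

theorem cos_sub_isBigO_four : (fun x => cos x - (1 - x ^ 2 / 2)) =O[𝓝 0] fun x => x ^ 4 :=
  isBigO_pow_succ_of_hasDerivAt (.of_forall fun x => ((hasDerivAt_cos x).sub
    (((hasDerivAt_pow 2 x).div_const 2).const_sub 1))) (by simp)
    (sin_sub_isBigO_three.neg_left.congr_left fun x => by push_cast; ring)

theorem sin_sub_isBigO_five :
    (fun x => sin x - (x - x ^ 3 / 6)) =O[𝓝 0] fun x => x ^ 5 :=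
  isBigO_pow_succ_of_hasDerivAt (.of_forall fun x => ((hasDerivAt_sin x).sub
    ((hasDerivAt_id x).sub ((hasDerivAt_pow 3 x).div_const 6)))) (by simp)
    (cos_sub_isBigO_four.congr_left fun x => by push_cast; ring)

theorem cos_sub_isBigO_six :
    (fun x => cos x - (1 - x ^ 2 / 2 + x ^ 4 / 24)) =O[𝓝 0] fun x => x ^ 6 :=
  isBigO_pow_succ_of_hasDerivAt (.of_forall fun x => ((hasDerivAt_cos x).sub
    ((((hasDerivAt_pow 2 x).div_const 2).const_sub 1).add
      ((hasDerivAt_pow 4 x).div_const 24)))) (by simp)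
    (sin_sub_isBigO_five.neg_left.congr_left fun x => by push_cast; ring)

theorem sinh_isBigO : sinh =O[𝓝 0] fun x => x ^ 1 :=
  isBigO_pow_succ_of_hasDerivAt (.of_forall hasDerivAt_sinh) sinh_zero
    (isBigO_one_of_continuousAt continuous_cosh.continuousAt)

theorem cosh_sub_isBigO_two : (fun x => cosh x - 1) =O[𝓝 0] fun x => x ^ 2 :=
  isBigO_pow_succ_of_hasDerivAt (.of_forall fun x => (hasDerivAt_cosh x).sub_const 1) (by simp)
    sinh_isBigO

theorem sinh_sub_isBigO_three : (fun x => sinh x - x) =O[𝓝 0] fun x => x ^ 3 :=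
  isBigO_pow_succ_of_hasDerivAt (.of_forall fun x => (hasDerivAt_sinh x).sub (hasDerivAt_id x))
    (by simp) cosh_sub_isBigO_two

theorem cosh_sub_isBigO_four : (fun x => cosh x - (1 + x ^ 2 / 2)) =O[𝓝 0] fun x => x ^ 4 :=
  isBigO_pow_succ_of_hasDerivAt (.of_forall fun x => ((hasDerivAt_cosh x).sub
    (((hasDerivAt_pow 2 x).div_const 2).const_add 1))) (by simp)
    (sinh_sub_isBigO_three.congr_left fun x => by push_cast; ring)

theorem sinh_sub_isBigO_five :
    (fun x => sinh x - (x + x ^ 3 / 6)) =O[𝓝 0] fun x => x ^ 5 :=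
  isBigO_pow_succ_of_hasDerivAt (.of_forall fun x => ((hasDerivAt_sinh x).sub
    ((hasDerivAt_id x).add ((hasDerivAt_pow 3 x).div_const 6)))) (by simp)
    (cosh_sub_isBigO_four.congr_left fun x => by push_cast; ring)

theorem cosh_sub_isBigO_six :
    (fun x => cosh x - (1 + x ^ 2 / 2 + x ^ 4 / 24)) =O[𝓝 0] fun x => x ^ 6 :=
  isBigO_pow_succ_of_hasDerivAt (.of_forall fun x => ((hasDerivAt_cosh x).sub
    ((((hasDerivAt_pow 2 x).div_const 2).const_add 1).add
      ((hasDerivAt_pow 4 x).div_const 24)))) (by simp)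
    (sinh_sub_isBigO_five.congr_left fun x => by push_cast; ring)

theorem arctan_sub_isBigO_three : (fun x => arctan x - x) =O[𝓝 0] fun x => x ^ 3 := by
  refine isBigO_pow_succ_of_hasDerivAt (f' := fun x => 1 / (1 + x ^ 2) - 1)
    (.of_forall fun x => (hasDerivAt_arctan x).sub (hasDerivAt_id x)) (by simp)
    (IsBigO.of_bound 1 (.of_forall fun x => ?_))
  have h : 1 / (1 + x ^ 2) - 1 = -(x ^ 2 / (1 + x ^ 2)) := by
    have : (1 + x ^ 2) ≠ 0 := by positivity
    field_simp; ring
  rw [h, norm_neg, one_mul, norm_div]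
  apply div_le_self (norm_nonneg _)
  rw [norm_eq_abs, abs_of_pos (by positivity)]
  nlinarith [sq_nonneg x]

/-- The expansion of solutions of `f' = 1 + σ f ^ 2`, `f 0 = 0`, such as `tan` and `tanh`. -/
theorem sub_isBigO_five_of_riccati {f : ℝ → ℝ} {σ : ℝ}
    (hf : ∀ᶠ x in 𝓝 0, HasDerivAt f (1 + σ * f x ^ 2) x) (h0 : f 0 = 0) :
    (fun x => f x - (x + σ * x ^ 3 / 3)) =O[𝓝 0] fun x => x ^ 5 := by
  -- Bootstrap: f = O(x) gives f' - 1 = O(x²), so f - x = O(x³); then f² - x² = (f - x)(f + x) =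
  -- O(x⁴) yields the final order.
  have h1 : f =O[𝓝 0] fun x => x ^ 1 := isBigO_pow_succ_of_hasDerivAt hf h0 <| by
    have hc : ContinuousAt f 0 := hf.self_of_nhds.continuousAt
    exact isBigO_one_of_continuousAt (by fun_prop)
  have hid : (fun x : ℝ => x) =O[𝓝 0] fun x => x ^ 1 := by simpa using isBigO_refl _ _
  have h3 : (fun x => f x - x) =O[𝓝 0] fun x => x ^ 3 := by
    refine isBigO_pow_succ_of_hasDerivAt (hf.mono fun x hx => hx.sub (hasDerivAt_id x)) (by simp [h0])
      (((h1.mul h1).const_mul_left σ).congr (fun x => by ring) fun x => by ring)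
  refine isBigO_pow_succ_of_hasDerivAt (hf.mono fun x hx => hx.sub ((hasDerivAt_id x).add
    (((hasDerivAt_pow 3 x).const_mul σ).div_const 3))) (by simp [h0])
    (((h3.mul (h1.add hid)).const_mul_left σ).congr (fun x => by push_cast; ring)
      fun x => by ring)

theorem tan_sub_isBigO_five : (fun x => tan x - (x + x ^ 3 / 3)) =O[𝓝 0] fun x => x ^ 5 := by
  have h := sub_isBigO_five_of_riccati (f := tan) (σ := 1) ?_ tan_zero
  · simpa using h
  filter_upwards [continuous_cos.continuousAt.eventually_ne (by simp : cos 0 ≠ 0)] with x hx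
  refine (hasDerivAt_tan hx).congr_deriv ?_
  rw [tan_eq_sin_div_cos]
  field_simp
  linarith [sin_sq_add_cos_sq x]

theorem tanh_sub_isBigO_five : (fun x => tanh x - (x - x ^ 3 / 3)) =O[𝓝 0] fun x => x ^ 5 := by
  have h := sub_isBigO_five_of_riccati (f := tanh) (σ := -1) ?_ tanh_zero
  · exact h.congr_left fun x => by ring
  refine .of_forall fun x => ?_
  have hx := (cosh_pos x).ne'
  have h := (hasDerivAt_sinh x).div (hasDerivAt_cosh x) hx
  have e : (sinh / cosh) = tanh := funext fun y => (tanh_eq_sinh_div_cosh y).symm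
  rw [e] at h
  refine h.congr_deriv ?_
  rw [tanh_eq_sinh_div_cosh]
  field_simp
  ring

/-! ### Bounded families -/

section families

variable {ι : Type*} {l : Filter ι}

theorem eventually_abs_le_of_isBigO_one {x : ι → ℝ} (hx : x =O[l] fun _ => (1 : ℝ)) :
    ∃ M : ℝ, ∀ᶠ i in l, |x i| ≤ M := by
  obtain ⟨M, hM⟩ := hx.bound
  exact ⟨M, by simpa using hM⟩

theorem comp_isBigO_one {f : ℝ → ℝ} (hf : Continuous f) {x : ι → ℝ}
    (hx : x =O[l] fun _ => (1 : ℝ)) : (fun i => f (x i)) =O[l] fun _ => (1 : ℝ) := by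
  obtain ⟨M, hM⟩ := eventually_abs_le_of_isBigO_one hx
  obtain ⟨C, hC⟩ := (isCompact_Icc (a := -M) (b := M)).exists_bound_of_continuousOn hf.continuousOn
  exact IsBigO.of_bound C (hM.mono fun i hi => by simpa using hC (x i) (abs_le.1 hi))

theorem comp_sub_comp_isBigO {f f' : ℝ → ℝ} (hf : ∀ x, HasDerivAt f (f' x) x)
    (hf' : Continuous f') {x y : ι → ℝ} (hx : x =O[l] fun _ => (1 : ℝ))
    (hy : y =O[l] fun _ => (1 : ℝ)) :
    (fun i => f (x i) - f (y i)) =O[l] fun i => x i - y i := by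
  obtain ⟨M, hM⟩ := eventually_abs_le_of_isBigO_one hx
  obtain ⟨N, hN⟩ := eventually_abs_le_of_isBigO_one hy
  obtain ⟨C, hC⟩ := (isCompact_Icc (a := -max M N) (b := max M N)).exists_bound_of_continuousOn
    hf'.continuousOn
  refine IsBigO.of_bound C ?_
  filter_upwards [hM, hN] with i h1 h2
  exact abs_sub_le_of_hasDerivAt (N := max M N) (fun z _ => hf z) (fun z hz => hC z (abs_le.1 hz))
    (h1.trans (le_max_left _ _)) (h2.trans (le_max_right _ _))

theorem comp_taylor_isBigO {f : ℝ → ℝ} {n : ℕ} (hf : f =O[𝓝 0] fun x => x ^ n) {x ε : ι → ℝ}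
    (hε : Tendsto ε l (𝓝 0)) (hx : x =O[l] ε) :
    (fun i => f (x i)) =O[l] fun i => ε i ^ n :=
  (hf.comp_tendsto (hx.trans_tendsto hε)).trans (hx.pow n)

variable {ε : ι → ℝ}

theorem tendsto_zero_of_nhdsGT (hε : Tendsto ε l (𝓝[>] 0)) : Tendsto ε l (𝓝 0) :=
  hε.mono_right nhdsWithin_le_nhds

theorem pow_isBigO_pow (hε : Tendsto ε l (𝓝[>] 0)) {m n : ℕ} (h : m ≤ n) :
    (fun i => ε i ^ n) =O[l] fun i => ε i ^ m := by
  refine IsBigO.of_bound 1 ?_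
  filter_upwards [hε.eventually (Ioo_mem_nhdsGT (one_pos : (0 : ℝ) < 1))] with i hi
  rw [norm_eq_abs, norm_eq_abs, abs_of_pos (pow_pos hi.1 _), abs_of_pos (pow_pos hi.1 _), one_mul]
  exact pow_le_pow_of_le_one hi.1.le hi.2.le h

theorem isBigO_one_of_pow (hε : Tendsto ε l (𝓝[>] 0)) {f : ι → ℝ} {n : ℕ}
    (hf : f =O[l] fun i => ε i ^ n) : f =O[l] fun _ => (1 : ℝ) :=
  hf.trans (by simpa using pow_isBigO_pow hε (Nat.zero_le n))

/-! ### Expansion of the phases and of the ring products. -/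

theorem phaseRatio_sub_isBigO (hε : Tendsto ε l (𝓝[>] 0)) {x : ι → ℝ}
    (hx : x =O[l] fun _ => (1 : ℝ)) :
    (∀ᶠ i in l, ∃ s, ellipticF √(1 - ε i ^ 2) (arctan s) = x i) ∧
    (fun i => phaseRatio √(1 - ε i ^ 2) (x i) - sinh (2 * x i) / 2) =O[l]
      fun i => ε i ^ 2 * x i := by
  obtain ⟨M, hM⟩ := eventually_abs_le_of_isBigO_one hx
  obtain ⟨C, hC⟩ := exists_ellipticF_arctan_eq M
  have h := (hε.eventually hC).and hM
  refine ⟨h.mono fun i hi => (hi.1 _ hi.2).1, IsBigO.of_bound C (h.mono fun i hi => ?_)⟩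
  have := (hi.1 _ hi.2).2
  rwa [norm_eq_abs, norm_eq_abs, abs_mul, abs_of_nonneg (sq_nonneg (ε i))]

theorem one_sub_modulus_isBigO (hε : Tendsto ε l (𝓝[>] 0)) :
    (fun i => 1 - √(1 - ε i ^ 2)) =O[l] fun i => ε i ^ 2 := by
  refine IsBigO.of_bound 1 ?_
  filter_upwards [hε.eventually (Ioo_mem_nhdsGT (one_pos : (0 : ℝ) < 1))] with i hi
  have h := sq_sqrt_one_sub_add hi.1 hi.2
  have h0 := sqrt_nonneg (1 - ε i ^ 2)
  have h1 : √(1 - ε i ^ 2) ≤ 1 := sqrt_le_one.2 (by nlinarith)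
  rw [norm_eq_abs, norm_eq_abs, abs_of_nonneg (by linarith), abs_of_nonneg (sq_nonneg _)]
  nlinarith

/-- From q² + ε² = 1 the remainder is exactly (1-q)²/2. -/
theorem one_sub_modulus_sub_isBigO (hε : Tendsto ε l (𝓝[>] 0)) :
    (fun i => 1 - √(1 - ε i ^ 2) - ε i ^ 2 / 2) =O[l] fun i => ε i ^ 4 := by
  refine (((one_sub_modulus_isBigO hε).mul (one_sub_modulus_isBigO hε)).const_mul_left
    (1 / 2)).congr' ?_ (.of_forall fun i => by ring)
  filter_upwards [hε.eventually (Ioo_mem_nhdsGT (one_pos : (0 : ℝ) < 1))] with i hi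
  linear_combination (1 / 2) * sq_sqrt_one_sub_add hi.1 hi.2

/-- The argument is small here, so 1+q = 2 + O(ε²), f(x) = x + O(ε³), and arctan is the identity up
to third order. -/
theorem numPhase_sub_isBigO (hε : Tendsto ε l (𝓝[>] 0)) {x : ι → ℝ} (hx : x =O[l] ε) :
    (fun i => numPhase √(1 - ε i ^ 2) (x i) - 2 * x i) =O[l] fun i => ε i ^ 3 := by
  have hε0 := tendsto_zero_of_nhdsGT hε
  have h1 := (phaseRatio_sub_isBigO hε (hx.trans (hε0.isBigO_one ℝ))).2
  have h2 : (fun i => sinh (2 * x i) - 2 * x i) =O[l] fun i => ε i ^ 3 :=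
    comp_taylor_isBigO sinh_sub_isBigO_three hε0 (hx.const_mul_left 2)
  have h3 : (fun i => phaseRatio √(1 - ε i ^ 2) (x i) - x i) =O[l] fun i => ε i ^ 3 := by
    have h1' := h1.trans (((isBigO_refl (fun i => ε i ^ 2) l).mul hx).trans_eventuallyEq
      (.of_eq (funext fun i => (pow_succ (ε i) 2).symm)))
    exact (h1'.add (h2.const_mul_left (1 / 2))).congr_left fun i => by ring
  have h4 : (fun i => phaseRatio √(1 - ε i ^ 2) (x i)) =O[l] ε := by
    have := (h3.trans (pow_isBigO_pow hε (by norm_num : 1 ≤ 3)))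
    simp only [pow_one] at this
    exact (this.add hx).congr_left fun i => by ring
  have h5 : (fun i => (1 + √(1 - ε i ^ 2)) * phaseRatio √(1 - ε i ^ 2) (x i) - 2 * x i) =O[l]
      fun i => ε i ^ 3 := by
    have h := ((one_sub_modulus_isBigO hε).mul h4).congr_right fun i => (pow_succ (ε i) 2).symm
    exact ((h3.const_mul_left 2).sub h).congr_left fun i => by ring
  have h6 : (fun i => (1 + √(1 - ε i ^ 2)) * phaseRatio √(1 - ε i ^ 2) (x i)) =O[l] ε := by
    have := (h5.trans (pow_isBigO_pow hε (by norm_num : 1 ≤ 3)))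
    simp only [pow_one] at this
    exact (this.add (hx.const_mul_left 2)).congr_left fun i => by ring
  exact ((comp_taylor_isBigO arctan_sub_isBigO_three hε0 h6).add h5).congr_left fun i => by
    rw [numPhase]; ring

/-- The argument is only bounded, but 1-q = ε²/2 + O(ε⁴) makes the phase small. Hence replacing the
midpoint x by the centre v, an error O(ε), is harmless. -/
theorem denPhase_sub_isBigO (hε : Tendsto ε l (𝓝[>] 0)) {x v : ι → ℝ}
    (hv : v =O[l] fun _ => (1 : ℝ)) (hx : (fun i => x i - v i) =O[l] ε) :
    (fun i => denPhase √(1 - ε i ^ 2) (x i) - ε i ^ 2 * sinh (2 * v i) / 4) =O[l]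
      fun i => ε i ^ 3 := by
  have hε0 := tendsto_zero_of_nhdsGT hε
  have hε1 := hε0.isBigO_one ℝ
  have hx1 : x =O[l] fun _ => (1 : ℝ) :=
    ((hx.trans hε1).add hv).congr_left fun i => by ring
  have h1 : (fun i => phaseRatio √(1 - ε i ^ 2) (x i) - sinh (2 * x i) / 2) =O[l] ε := by
    have h := ((isBigO_refl (fun i => ε i ^ 2) l).mul hx1).trans
      ((pow_isBigO_pow hε (by norm_num : 1 ≤ 2)).congr_left fun i => (mul_one _).symm)
    simp only [pow_one] at h
    exact (phaseRatio_sub_isBigO hε hx1).2.trans h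
  have h2 : (fun i => sinh (2 * x i) - sinh (2 * v i)) =O[l] ε :=
    (comp_sub_comp_isBigO hasDerivAt_sinh continuous_cosh (hx1.const_mul_left 2)
      (hv.const_mul_left 2)).trans ((hx.const_mul_left 2).congr_left fun i => by ring)
  have h3 : (fun i => phaseRatio √(1 - ε i ^ 2) (x i) - sinh (2 * v i) / 2) =O[l] ε :=
    (h1.add (h2.const_mul_left (1 / 2))).congr_left fun i => by ring
  have hs : (fun i => sinh (2 * v i)) =O[l] fun _ => (1 : ℝ) :=
    comp_isBigO_one continuous_sinh (hv.const_mul_left 2)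
  have h4 : (fun i => (1 - √(1 - ε i ^ 2)) * phaseRatio √(1 - ε i ^ 2) (x i)
      - ε i ^ 2 * sinh (2 * v i) / 4) =O[l] fun i => ε i ^ 3 := by
    have ha := ((one_sub_modulus_isBigO hε).mul h3).congr_right fun i => (pow_succ (ε i) 2).symm
    have hb := (((one_sub_modulus_sub_isBigO hε).mul hs).congr_right fun i => mul_one _).trans
      (pow_isBigO_pow hε (by norm_num : 3 ≤ 4))
    exact (ha.add (hb.const_mul_left (1 / 2))).congr_left fun i => by ring
  have h5 : (fun i => (1 - √(1 - ε i ^ 2)) * phaseRatio √(1 - ε i ^ 2) (x i)) =O[l] ε := by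
    have ha := h4.trans (pow_isBigO_pow hε (by norm_num : 1 ≤ 3))
    have hb := ((isBigO_refl (fun i => ε i ^ 2) l).mul hs).trans
      ((pow_isBigO_pow hε (by norm_num : 1 ≤ 2)).congr_left fun i => (mul_one _).symm)
    simp only [pow_one] at ha hb
    exact (ha.add (hb.const_mul_left (1 / 4))).congr_left fun i => by ring
  exact ((comp_taylor_isBigO arctan_sub_isBigO_three hε0 h5).add h4).congr_left fun i => by
    rw [denPhase]; ring

/-- As Θ = O(ε²), the quadratic remainder of the exponential is already O(ε⁴). -/
theorem exp_neg_mul_I_sub_isBigO (hε : Tendsto ε l (𝓝[>] 0)) {Θ θ : ι → ℝ}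
    (hΘ : (fun i => Θ i - θ i) =O[l] fun i => ε i ^ 3) (hθ : θ =O[l] fun i => ε i ^ 2) :
    (fun i => Complex.exp (-((Θ i : ℝ) * Complex.I)) - 1 + Complex.I * (θ i : ℂ)) =O[l]
      fun i => ε i ^ 3 := by
  have hΘ2 : Θ =O[l] fun i => ε i ^ 2 :=
    ((hΘ.trans (pow_isBigO_pow hε (by norm_num))).add hθ).congr_left fun i => by ring
  have hε0 := tendsto_zero_of_nhdsGT hε
  have hΘ0 : Tendsto Θ l (𝓝 0) := hΘ2.trans_tendsto (by simpa using hε0.pow 2)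
  have h1 : (fun i => Complex.exp (-((Θ i : ℝ) * Complex.I)) - 1 - -((Θ i : ℝ) * Complex.I))
      =O[l] fun i => ε i ^ 3 := by
    have : (fun i => Complex.exp (-((Θ i : ℝ) * Complex.I)) - 1 - -((Θ i : ℝ) * Complex.I))
        =O[l] fun i => Θ i ^ 2 := by
      refine IsBigO.of_bound 1 ?_
      have := hΘ0.abs
      rw [abs_zero] at this
      filter_upwards [this.eventually_le_const one_pos] with i hi
      have := Complex.norm_exp_sub_one_sub_id_le (x := -((Θ i : ℝ) * Complex.I)) (by simpa using hi)
      simpa using this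
    exact this.trans (((hΘ2.pow 2).congr_right fun i => (pow_mul (ε i) 2 2).symm).trans
      (pow_isBigO_pow hε (by norm_num)))
  have h2 : (fun i => ((Θ i - θ i : ℝ) : ℂ) * Complex.I) =O[l] fun i => ε i ^ 3 := by
    refine IsBigO.trans (IsBigO.of_bound 1 (.of_forall fun i => ?_)) hΘ
    rw [norm_mul, Complex.norm_real, Complex.norm_I, mul_one, one_mul]
  exact (h1.sub h2).congr_left fun i => by push_cast; ring

/-- The expansion of the left hand sides of the ring equations for families of variables. -/
theorem ringProd_sub_isBigO (hε : Tendsto ε l (𝓝[>] 0)) {w : ι → Fin 5 → ℝ}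
    (hw0 : (fun i => w i 0) =O[l] fun _ => (1 : ℝ))
    (hw : ∀ k : Fin 4, (fun i => w i k.succ - w i 0) =O[l] ε)
    (hs : (fun i => ∑ k : Fin 4, (w i k.succ - w i 0)) =O[l] fun i => ε i ^ 2) :
    (fun i => sphericalProd √(1 - ε i ^ 2) (fun j => ellipticK √(1 - ε i ^ 2) - w i j) - 1 +
      Complex.I * ((∑ k : Fin 4, (w i k.succ - w i 0) + ε i ^ 2 * sinh (2 * w i 0) : ℝ) : ℂ))
        =O[l] (fun i => ε i ^ 3) ∧
    (fun i => hyperbolicProd √(1 - ε i ^ 2) (fun j => ellipticK √(1 - ε i ^ 2) - w i j) - 1 +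
      Complex.I * ((∑ k : Fin 4, (w i k.succ - w i 0) - ε i ^ 2 * sinh (2 * w i 0) : ℝ) : ℂ))
        =O[l] (fun i => ε i ^ 3) := by
  have hε1 := (tendsto_zero_of_nhdsGT hε).isBigO_one ℝ
  have hy : ∀ k : Fin 4, (fun i => (w i k.succ - w i 0) / 2) =O[l] ε := fun k =>
    ((hw k).const_mul_left (1 / 2)).congr_left fun i => by ring
  have hz : ∀ k : Fin 4, (fun i => (w i 0 + w i k.succ) / 2 - w i 0) =O[l] ε := fun k =>
    (hy k).congr_left fun i => by ring
  have hz1 : ∀ k : Fin 4, (fun i => (w i 0 + w i k.succ) / 2) =O[l] fun _ => (1 : ℝ) := fun k =>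
    (((hz k).trans hε1).add hw0).congr_left fun i => by ring
  have hsinh := comp_isBigO_one continuous_sinh (hw0.const_mul_left 2)
  have hsinh2 : (fun i => ε i ^ 2 * sinh (2 * w i 0)) =O[l] fun i => ε i ^ 2 :=
    ((isBigO_refl (fun i => ε i ^ 2) l).mul hsinh).congr_right fun i => mul_one _
  have hnum := IsBigO.sum (s := Finset.univ) fun k _ => numPhase_sub_isBigO hε (hy k)
  have hden := IsBigO.sum (s := Finset.univ) fun k _ => denPhase_sub_isBigO hε hw0 (hz k)
  have hey := fun k => (phaseRatio_sub_isBigO hε ((hy k).trans hε1)).1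
  have hez := fun k => (phaseRatio_sub_isBigO hε (hz1 k)).1
  have hk : ∀ᶠ i in l, √(1 - ε i ^ 2) ^ 2 + ε i ^ 2 = 1 ∧ 0 < √(1 - ε i ^ 2) ∧ 0 < ε i := by
    filter_upwards [hε.eventually (Ioo_mem_nhdsGT (one_pos : (0 : ℝ) < 1))] with i hi
    exact ⟨sq_sqrt_one_sub_add hi.1 hi.2, sqrt_pos.2 (by nlinarith [hi.1, hi.2]), hi.1⟩
  constructor
  -- Each numerator phase contributes 2·(w_k - w_0)/2, and the four denominator phases add up to
  -- 4·ε² sinh(2w_0)/4.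
  · have hΘ := (hnum.add hden).congr_left (f₂ := fun i => ∑ k : Fin 4,
      (numPhase √(1 - ε i ^ 2) ((w i k.succ - w i 0) / 2) +
        denPhase √(1 - ε i ^ 2) ((w i 0 + w i k.succ) / 2)) -
      (∑ k : Fin 4, (w i k.succ - w i 0) + ε i ^ 2 * sinh (2 * w i 0))) fun i => by
        simp only [Fin.sum_univ_four, Pi.add_apply]; ring
    refine (exp_neg_mul_I_sub_isBigO hε hΘ (hs.add hsinh2)).congr' ?_ .rfl
    filter_upwards [hk, eventually_all.2 hey, eventually_all.2 hez] with i h1 h2 h3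
    rw [sphericalProd_eq_exp h1.1 h1.2.1 h1.2.2 (w i) h2 h3]
  · have hΘ := (hnum.sub hden).congr_left (f₂ := fun i => ∑ k : Fin 4,
      (numPhase √(1 - ε i ^ 2) ((w i k.succ - w i 0) / 2) -
        denPhase √(1 - ε i ^ 2) ((w i 0 + w i k.succ) / 2)) -
      (∑ k : Fin 4, (w i k.succ - w i 0) - ε i ^ 2 * sinh (2 * w i 0))) fun i => by
        simp only [Fin.sum_univ_four, Pi.add_apply]; ring
    refine (exp_neg_mul_I_sub_isBigO hε hΘ (hs.sub hsinh2)).congr' ?_ .rfl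
    filter_upwards [hk, eventually_all.2 hey, eventually_all.2 hez] with i h1 h2 h3
    rw [hyperbolicProd_eq_exp h1.1 h1.2.1 h1.2.2 (w i) h2 h3]

end families

/-! ### Uniform Taylor expansion on the stencil. -/

/-- Three applications of the mean value inequality, without integrating the powers of t; hence the
constant L in place of L/6. -/
theorem abs_taylor_two_le {f f₁ f₂ f₃ : ℝ → ℝ} {h L : ℝ}
    (hf : ∀ t, |t| ≤ h → HasDerivAt f (f₁ t) t) (hf₁ : ∀ t, |t| ≤ h → HasDerivAt f₁ (f₂ t) t)
    (hf₂ : ∀ t, |t| ≤ h → HasDerivAt f₂ (f₃ t) t) (hL : ∀ t, |t| ≤ h → |f₃ t| ≤ L)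
    {t : ℝ} (ht : |t| ≤ h) :
    |f t - f 0 - t * f₁ 0 - t ^ 2 / 2 * f₂ 0| ≤ L * |t| ^ 3 := by
  have hle : ∀ s : ℝ, |s| ≤ |t| → |s| ≤ h := fun s hs => hs.trans ht
  have hL0 : 0 ≤ L := (abs_nonneg _).trans (hL t ht)
  have h0 : |(0 : ℝ)| ≤ |t| := by simp
  have b2 : ∀ s, |s| ≤ |t| → |f₂ s - f₂ 0| ≤ L * |t| := fun s hs => by
    have := abs_sub_le_of_hasDerivAt (fun x hx => hf₂ x (hle x hx)) (fun x hx => hL x (hle x hx))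
      hs h0
    rw [sub_zero] at this
    exact this.trans (by gcongr)
  have b1 : ∀ s, |s| ≤ |t| → |f₁ s - (f₁ 0 + s * f₂ 0)| ≤ L * |t| ^ 2 := fun s hs => by
    have := abs_sub_le_of_hasDerivAt (f := fun s => f₁ s - (f₁ 0 + s * f₂ 0))
      (fun x hx => (hf₁ x (hle x hx)).sub (((hasDerivAt_id x).mul_const (f₂ 0)).const_add (f₁ 0)))
      (fun x hx => by simpa using b2 x hx) hs h0
    simp only [zero_mul, add_zero, sub_self, sub_zero] at this
    refine this.trans ?_
    rw [pow_two, ← mul_assoc]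
    gcongr
  have b0 := abs_sub_le_of_hasDerivAt
    (f := fun s => f s - f 0 - s * f₁ 0 - s ^ 2 / 2 * f₂ 0)
    (fun x hx => (((hf x (hle x hx)).sub_const (f 0)).sub
      ((hasDerivAt_id x).mul_const (f₁ 0))).sub
        (((hasDerivAt_pow 2 x).div_const 2).mul_const (f₂ 0)))
    (fun x hx => by
      refine le_trans (le_of_eq ?_) (b1 x hx)
      congr 1
      push_cast
      ring) (le_refl |t|) h0
  simpa [pow_succ, mul_assoc] using b0

theorem hasDerivAt_line {E : Type*} [NormedAddCommGroup E] [NormedSpace ℝ E] {f : E → ℝ} {p e : E}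
    {s : ℝ} (hf : DifferentiableAt ℝ f (p + s • e)) :
    HasDerivAt (fun s : ℝ => f (p + s • e)) (fderiv ℝ f (p + s • e) e) s := by
  have h : HasDerivAt (fun s : ℝ => p + s • e) e s := by
    simpa using ((hasDerivAt_id s).smul_const e).const_add p
  exact hf.hasFDerivAt.comp_hasDerivAt s h

theorem fderiv_fderiv_apply {E : Type*} [NormedAddCommGroup E] [NormedSpace ℝ E] {u : E → ℝ} {p : E}
    (hu : DifferentiableAt ℝ (fderiv ℝ u) p) (e : E) :
    fderiv ℝ (fun x => fderiv ℝ u x e) p e = fderiv ℝ (fderiv ℝ u) p e e := by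
  rw [fderiv_clm_apply hu (differentiableAt_const e)]
  simp

/-- Uniform Taylor expansion of second order in a fixed direction near a compact set. -/
theorem exists_uniform_taylor {E : Type*} [NormedAddCommGroup E] [NormedSpace ℝ E] [ProperSpace E]
    {U S : Set E} {u : E → ℝ} (hU : IsOpen U) (hu : ContDiffOn ℝ 3 u U) (hS : IsCompact S)
    (hSU : S ⊆ U) {e : E} (he : ‖e‖ = 1) : ∃ δ C : ℝ, 0 < δ ∧ ∀ p ∈ S, |u p| ≤ C ∧
      |fderiv ℝ (fderiv ℝ u) p e e| ≤ C ∧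
      ∀ t : ℝ, |t| ≤ δ → p + t • e ∈ U ∧ |u (p + t • e) - u p| ≤ C * |t| ∧
        |u (p + t • e) - u p - t * fderiv ℝ u p e - t ^ 2 / 2 * fderiv ℝ (fderiv ℝ u) p e e|
          ≤ C * |t| ^ 3 := by
  -- A closed thickening of S is compact, stays in U and contains every segment of length δ issuing
  -- from S, so bounds for derivatives on it are uniform.
  obtain ⟨δ, hδ, hδU⟩ := hS.exists_cthickening_subset_open hU hSU
  have hK : IsCompact (Metric.cthickening δ S) := hS.cthickening
  obtain ⟨f₁, hf₁⟩ : ∃ f : E → ℝ, f = fun x => fderiv ℝ u x e := ⟨_, rfl⟩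
  obtain ⟨f₂, hf₂⟩ : ∃ f : E → ℝ, f = fun x => fderiv ℝ f₁ x e := ⟨_, rfl⟩
  obtain ⟨f₃, hf₃⟩ : ∃ f : E → ℝ, f = fun x => fderiv ℝ f₂ x e := ⟨_, rfl⟩
  have h₁ : ContDiffOn ℝ 2 f₁ U := hf₁ ▸
    (hu.fderiv_of_isOpen hU (by norm_num)).clm_apply contDiffOn_const
  have h₂ : ContDiffOn ℝ 1 f₂ U := hf₂ ▸
    (h₁.fderiv_of_isOpen hU (by norm_num)).clm_apply contDiffOn_const
  have h₃ : ContDiffOn ℝ 0 f₃ U := hf₃ ▸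
    (h₂.fderiv_of_isOpen hU (by norm_num)).clm_apply contDiffOn_const
  have e₂ : ∀ p ∈ U, f₂ p = fderiv ℝ (fderiv ℝ u) p e e := fun p hp => by
    rw [hf₂, hf₁]
    exact fderiv_fderiv_apply (((hu.fderiv_of_isOpen (m := 2) hU (by norm_num)).contDiffAt
      (hU.mem_nhds hp)).differentiableAt (by norm_num)) e
  obtain ⟨C₀, hC₀⟩ := hK.exists_bound_of_continuousOn (hu.continuousOn.mono hδU)
  obtain ⟨C₁, hC₁⟩ := hK.exists_bound_of_continuousOn (h₁.continuousOn.mono hδU)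
  obtain ⟨C₂, hC₂⟩ := hK.exists_bound_of_continuousOn (h₂.continuousOn.mono hδU)
  obtain ⟨C₃, hC₃⟩ := hK.exists_bound_of_continuousOn (h₃.continuousOn.mono hδU)
  obtain ⟨C, hC⟩ : ∃ C, C = max (max C₀ C₁) (max C₂ C₃) := ⟨_, rfl⟩
  have c₀ : C₀ ≤ C := hC ▸ (le_max_left _ _).trans (le_max_left _ _)
  have c₁ : C₁ ≤ C := hC ▸ (le_max_right _ _).trans (le_max_left _ _)
  have c₂ : C₂ ≤ C := hC ▸ (le_max_left _ _).trans (le_max_right _ _)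
  have c₃ : C₃ ≤ C := hC ▸ (le_max_right _ _).trans (le_max_right _ _)
  refine ⟨δ, C, hδ, fun p hp => ?_⟩
  have hpK := Metric.self_subset_cthickening (δ := δ) S hp
  rw [← e₂ p (hSU hp)]
  refine ⟨(hC₀ p hpK).trans c₀, (hC₂ p hpK).trans c₂, fun t ht => ?_⟩
  have hmem : ∀ s : ℝ, |s| ≤ δ → p + s • e ∈ Metric.cthickening δ S := fun s hs =>
    Metric.mem_cthickening_of_dist_le _ p _ _ hp (by simpa [norm_smul, he] using hs)
  have g₀ : ∀ s, |s| ≤ δ → HasDerivAt (fun s => u (p + s • e)) (f₁ (p + s • e)) s :=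
    fun s hs => by
      rw [hf₁]
      exact hasDerivAt_line ((hu.contDiffAt (hU.mem_nhds (hδU (hmem s hs)))).differentiableAt
        (by norm_num))
  have g₁ : ∀ s, |s| ≤ δ → HasDerivAt (fun s => f₁ (p + s • e)) (f₂ (p + s • e)) s :=
    fun s hs => by
      rw [hf₂]
      exact hasDerivAt_line ((h₁.contDiffAt (hU.mem_nhds (hδU (hmem s hs)))).differentiableAt
        (by norm_num))
  have g₂ : ∀ s, |s| ≤ δ → HasDerivAt (fun s => f₂ (p + s • e)) (f₃ (p + s • e)) s :=
    fun s hs => by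
      rw [hf₃]
      exact hasDerivAt_line ((h₂.contDiffAt (hU.mem_nhds (hδU (hmem s hs)))).differentiableAt
        (by norm_num))
  refine ⟨hδU (hmem t ht), ?_, ?_⟩
  · simpa using abs_sub_le_of_hasDerivAt g₀ (fun s hs => (hC₁ _ (hmem s hs)).trans c₁) ht (b := 0)
      (by simpa using hδ.le)
  · have := abs_taylor_two_le g₀ g₁ g₂ (fun s hs => (hC₃ _ (hmem s hs)).trans c₃) ht
    rw [zero_smul, add_zero] at this
    rwa [hf₁] at this

theorem laplacian_eq_fderiv_fderiv (u : EuclideanSpace ℝ (Fin 2) → ℝ)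
    (p : EuclideanSpace ℝ (Fin 2)) :
    Laplacian.laplacian u p =
      fderiv ℝ (fderiv ℝ u) p (EuclideanSpace.single 0 1) (EuclideanSpace.single 0 1) +
      fderiv ℝ (fderiv ℝ u) p (EuclideanSpace.single 1 1) (EuclideanSpace.single 1 1) := by
  rw [InnerProductSpace.laplacian_eq_iteratedFDeriv_orthonormalBasis u
    (EuclideanSpace.basisFun (Fin 2) ℝ)]
  simp [iteratedFDeriv_two_apply, Fin.sum_univ_two]

/-- The steps from the centre of a stencil to its neighbours. -/
theorem stencil_succ (ε : ℝ) (p : EuclideanSpace ℝ (Fin 2)) (k : Fin 4) :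
    stencil ε p k.succ = p + ((![ε, -ε, ε, -ε] : Fin 4 → ℝ) k) •
      (EuclideanSpace.single ((![0, 0, 1, 1] : Fin 4 → Fin 2) k) (1 : ℝ)) := by
  ext i
  fin_cases k <;> fin_cases i <;> simp [stencil, sub_eq_add_neg]

section stencil

variable {U S : Set (EuclideanSpace ℝ (Fin 2))} {u : EuclideanSpace ℝ (Fin 2) → ℝ}

theorem stencil_expansion (hU : IsOpen U) (hu : ContDiffOn ℝ 3 u U) (hS : IsCompact S)
    (hSU : S ⊆ U) {l : Filter (ℝ × EuclideanSpace ℝ (Fin 2))} (hl : l = 𝓝[>] 0 ×ˢ 𝓟 S) :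
    (∀ᶠ i in l, ∀ j, stencil i.1 i.2 j ∈ U) ∧
    (fun i => u (stencil i.1 i.2 0)) =O[l] (fun _ => (1 : ℝ)) ∧
    (∀ k : Fin 4, (fun i => u (stencil i.1 i.2 k.succ) - u (stencil i.1 i.2 0)) =O[l]
      fun i => i.1) ∧
    (fun i => Laplacian.laplacian u i.2) =O[l] (fun _ => (1 : ℝ)) ∧
    (fun i => ∑ k : Fin 4, (u (stencil i.1 i.2 k.succ) - u (stencil i.1 i.2 0)) -
      i.1 ^ 2 * Laplacian.laplacian u i.2) =O[l] (fun i => i.1 ^ 3) := by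
  have hnorm : ∀ j : Fin 2, ‖EuclideanSpace.single j (1 : ℝ)‖ = 1 := fun j => by simp
  choose δ C hδ h using fun j => exists_uniform_taylor hU hu hS hSU (hnorm j)
  have hev : ∀ᶠ i in l, (0 < i.1 ∧ ∀ j, i.1 ≤ δ j) ∧ i.2 ∈ S := by
    rw [hl, eventually_prod_principal_iff]
    filter_upwards [eventually_all.2 fun j => Ioc_mem_nhdsGT (hδ j), self_mem_nhdsWithin]
      with ε hε hε0 p hp
    exact ⟨⟨hε0, fun j => (hε j).2⟩, hp⟩
  have h0 : ∀ (ε : ℝ) (p : EuclideanSpace ℝ (Fin 2)), stencil ε p 0 = p := fun _ _ => rfl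
  have hstep : ∀ ε : ℝ, 0 < ε → ∀ k, |(![ε, -ε, ε, -ε] : Fin 4 → ℝ) k| = ε := fun ε hε k => by
    fin_cases k <;> simp [abs_of_pos hε]
  refine ⟨?_, ?_, fun k => ?_, ?_, ?_⟩
  · filter_upwards [hev] with i hi j
    refine Fin.cases ?_ (fun k => ?_) j
    · exact hSU hi.2
    · rw [stencil_succ]
      exact ((h _ _ hi.2).2.2 _ ((hstep _ hi.1.1 k).le.trans (hi.1.2 _))).1
  · exact IsBigO.of_bound (C 0) (hev.mono fun i hi => by simpa [h0] using (h 0 _ hi.2).1)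
  · refine IsBigO.of_bound (C (![0, 0, 1, 1] k)) (hev.mono fun i hi => ?_)
    have := ((h (![0, 0, 1, 1] k) _ hi.2).2.2 _ ((hstep _ hi.1.1 k).le.trans (hi.1.2 _))).2.1
    rw [stencil_succ, h0, norm_eq_abs, norm_eq_abs, abs_of_pos hi.1.1]
    rwa [hstep _ hi.1.1] at this
  · refine IsBigO.of_bound (C 0 + C 1) (hev.mono fun i hi => ?_)
    rw [laplacian_eq_fderiv_fderiv, norm_one, mul_one]
    exact (norm_add_le _ _).trans (add_le_add (h 0 _ hi.2).2.1 (h 1 _ hi.2).2.1)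
  -- On summation the first-order terms of opposite neighbours cancel, and the second-order terms
  -- add up to ε² times the Laplacian.
  · have ht : ∀ k : Fin 4, (fun i : ℝ × EuclideanSpace ℝ (Fin 2) =>
        u (stencil i.1 i.2 k.succ) - u (stencil i.1 i.2 0) -
        (![i.1, -i.1, i.1, -i.1] : Fin 4 → ℝ) k *
          fderiv ℝ u i.2 (EuclideanSpace.single (![0, 0, 1, 1] k) 1) -
        (![i.1, -i.1, i.1, -i.1] : Fin 4 → ℝ) k ^ 2 / 2 *
          fderiv ℝ (fderiv ℝ u) i.2 (EuclideanSpace.single (![0, 0, 1, 1] k) 1)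
            (EuclideanSpace.single (![0, 0, 1, 1] k) 1)) =O[l] fun i => i.1 ^ 3 := by
      intro k
      refine IsBigO.of_bound (C (![0, 0, 1, 1] k)) (hev.mono fun i hi => ?_)
      have := ((h (![0, 0, 1, 1] k) _ hi.2).2.2 _
        ((hstep _ hi.1.1 k).le.trans (hi.1.2 _))).2.2
      rw [stencil_succ, h0, norm_eq_abs, norm_eq_abs, abs_of_pos (pow_pos hi.1.1 3)]
      rwa [hstep _ hi.1.1] at this
    refine ((((ht 0).add (ht 1)).add (ht 2)).add (ht 3)).congr_left fun i => ?_
    rw [laplacian_eq_fderiv_fderiv, Fin.sum_univ_four]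
    simp
    ring

end stencil

/-! ### The uniformizing variables of rings -/

theorem am_nonneg_le_pi {k x : ℝ} (hk : k ^ 2 < 1) :
    (0 ≤ am k x ↔ 0 ≤ x) ∧ (am k x ≤ π ↔ x ≤ 2 * ellipticK k) := by
  have h := strictMono_ellipticF hk
  rw [← ellipticF_pi hk]
  refine ⟨?_, ?_⟩
  · rw [← h.le_iff_le, ellipticF_am hk, ellipticF_zero]
  · rw [← h.le_iff_le, ellipticF_am hk]

/-- The range of β means am β ∈ [0, π], where cos is injective, so the cn condition alone determines
β; the sn condition is then automatic. -/
theorem isSphericalVariable_iff {k r β : ℝ} (hk : k ^ 2 < 1) (hr : |r| ≤ π / 2) :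
    IsSphericalVariable k r β ↔ β = ellipticF k (π / 2 - r) := by
  have hr' := abs_le.1 hr
  constructor
  · rintro ⟨⟨h0, h1⟩, -, h3⟩
    rw [← (am_nonneg_le_pi hk).1] at h0
    rw [← (am_nonneg_le_pi hk).2] at h1
    have : am k β = π / 2 - r := by
      refine injOn_cos ⟨h0, h1⟩ ⟨by linarith, by linarith⟩ ?_
      rw [cos_pi_div_two_sub, h3, cn]
    rw [← this, ellipticF_am hk]
  · rintro rfl
    refine ⟨⟨?_, ?_⟩, ?_, ?_⟩
    · rw [← (am_nonneg_le_pi hk).1, am_ellipticF hk]; linarith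
    · rw [← (am_nonneg_le_pi hk).2, am_ellipticF hk]; linarith
    · rw [sn, am_ellipticF hk, sin_pi_div_two_sub]
    · rw [cn, am_ellipticF hk, cos_pi_div_two_sub]

/-- The open range puts π/2 - am γ in (-π/2, π/2), where its tangent cn/sn determines it. -/
theorem isHyperbolicVariable_iff {k r γ : ℝ} (hk : k ^ 2 < 1) :
    IsHyperbolicVariable k r γ ↔ γ = ellipticF k (π / 2 - arctan (sinh r)) := by
  have h := strictMono_ellipticF hk
  have hcot : ∀ φ : ℝ, tan (π / 2 - φ) = cos φ / sin φ := fun φ => by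
    rw [tan_eq_sin_div_cos, sin_pi_div_two_sub, cos_pi_div_two_sub]
  constructor
  · rintro ⟨⟨h0, h1⟩, h3⟩
    rw [← ellipticF_am hk γ, ← ellipticF_zero k, h.lt_iff_lt] at h0
    rw [← ellipticF_am hk γ, ← ellipticF_pi hk, h.lt_iff_lt] at h1
    rw [sn, cn, ← hcot] at h3
    rw [h3, arctan_tan (by linarith) (by linarith), sub_sub_cancel, ellipticF_am hk]
  · rintro rfl
    have h1 := arctan_lt_pi_div_two (sinh r)
    have h2 := neg_pi_div_two_lt_arctan (sinh r)
    refine ⟨⟨?_, ?_⟩, ?_⟩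
    · rw [← ellipticF_zero k]; exact h (by linarith)
    · rw [← ellipticF_pi hk]; exact h (by linarith)
    · rw [sn, cn, am_ellipticF hk, ← hcot, sub_sub_cancel, tan_arctan]

/-- The variable `K - β` of the spherical ring of inner radius `ε sinh v`. -/
noncomputable def sphericalShift (ε v : ℝ) : ℝ :=
  ellipticK √(1 - ε ^ 2) - ellipticF √(1 - ε ^ 2) (π / 2 - ε * sinh v)

/-- The variable `K - γ` of the hyperbolic ring of inner radius `ε sinh v`. -/
noncomputable def hyperbolicShift (ε v : ℝ) : ℝ :=
  ellipticK √(1 - ε ^ 2) - ellipticF √(1 - ε ^ 2) (π / 2 - arctan (sinh (ε * sinh v)))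

theorem sphericalShift_zero (ε : ℝ) : sphericalShift ε 0 = 0 := by
  simp [sphericalShift, ellipticK]

theorem hyperbolicShift_zero (ε : ℝ) : hyperbolicShift ε 0 = 0 := by
  simp [hyperbolicShift, ellipticK]

theorem sq_modulus_lt_one {ε : ℝ} (h0 : 0 < ε) (h1 : ε < 1) : √(1 - ε ^ 2) ^ 2 < 1 := by
  rw [sq_sqrt (by nlinarith)]
  nlinarith

theorem dn_ellipticF_pi_div_two_sub {ε : ℝ} (h0 : 0 < ε) (h1 : ε < 1) (r : ℝ) :
    dn √(1 - ε ^ 2) (ellipticF √(1 - ε ^ 2) (π / 2 - r)) = √(sin r ^ 2 + ε ^ 2 * cos r ^ 2) := by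
  rw [dn, sn, am_ellipticF (sq_modulus_lt_one h0 h1), sin_pi_div_two_sub, sq_sqrt (by nlinarith)]
  congr 1
  linear_combination -sin_sq_add_cos_sq r

theorem sin_sq_add_gudermann (ε r : ℝ) :
    √(sin (arctan (sinh r)) ^ 2 + ε ^ 2 * cos (arctan (sinh r)) ^ 2)
      = √(sinh r ^ 2 + ε ^ 2) / cosh r := by
  have h := cosh_pos r
  rw [sin_sq_arctan, cos_sq_arctan, ← cosh_sq', ← sqrt_sq h.le, ← sqrt_div (by positivity),
    sqrt_sq h.le]
  congr 1
  field_simp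

theorem hasDerivAt_ellipticF_pi_div_two_sub {ε : ℝ} (h0 : 0 < ε) (h1 : ε < 1) {g : ℝ → ℝ}
    {g' v : ℝ} (hg : HasDerivAt g g' v) :
    HasDerivAt (fun v => ellipticK √(1 - ε ^ 2) - ellipticF √(1 - ε ^ 2) (π / 2 - g v))
      (g' / √(sin (g v) ^ 2 + ε ^ 2 * cos (g v) ^ 2)) v := by
  have h := ((hasDerivAt_ellipticF (sq_modulus_lt_one h0 h1) (π / 2 - g v)).comp v
    (hg.const_sub (π / 2))).const_sub (ellipticK √(1 - ε ^ 2))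
  refine h.congr_deriv ?_
  have e : 1 - √(1 - ε ^ 2) ^ 2 * sin (π / 2 - g v) ^ 2 = sin (g v) ^ 2 + ε ^ 2 * cos (g v) ^ 2 := by
    rw [sq_sqrt (by nlinarith), sin_pi_div_two_sub]
    linear_combination -sin_sq_add_cos_sq (g v)
  rw [e]
  ring

theorem hasDerivAt_sphericalShift {ε : ℝ} (h0 : 0 < ε) (h1 : ε < 1) (v : ℝ) :
    HasDerivAt (sphericalShift ε) (ε * cosh v /
      √(sin (ε * sinh v) ^ 2 + ε ^ 2 * cos (ε * sinh v) ^ 2)) v :=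
  hasDerivAt_ellipticF_pi_div_two_sub h0 h1 ((hasDerivAt_sinh v).const_mul ε)

theorem hasDerivAt_hyperbolicShift {ε : ℝ} (h0 : 0 < ε) (h1 : ε < 1) (v : ℝ) :
    HasDerivAt (hyperbolicShift ε) (ε * cosh v / √(sinh (ε * sinh v) ^ 2 + ε ^ 2)) v := by
  refine (hasDerivAt_ellipticF_pi_div_two_sub h0 h1
    (((hasDerivAt_sinh v).const_mul ε).sinh.arctan)).congr_deriv ?_
  have h := cosh_pos (ε * sinh v)
  rw [sin_sq_add_gudermann, ← cosh_sq']
  have : √(sinh (ε * sinh v) ^ 2 + ε ^ 2) ≠ 0 := (sqrt_pos.2 (by positivity)).ne'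
  field_simp

/-! ### Comparison of the ring variables with the function v. -/

section families

variable {ι : Type*} {l : Filter ι} {ε : ι → ℝ}

theorem isBigO_pow_of_mul (hε : Tendsto ε l (𝓝[>] 0)) {f : ι → ℝ} {m n : ℕ}
    (hf : (fun i => ε i ^ m * f i) =O[l] fun i => ε i ^ (m + n)) :
    f =O[l] fun i => ε i ^ n := by
  obtain ⟨C, hC⟩ := hf.bound
  refine IsBigO.of_bound C ?_
  filter_upwards [hC, hε.eventually self_mem_nhdsWithin] with i hi h0
  have h0 : 0 < ε i := h0
  rw [norm_mul, pow_add, norm_mul, mul_left_comm] at hi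
  exact le_of_mul_le_mul_left hi (norm_pos_iff.2 (pow_pos h0 m).ne')

theorem mul_isBigO_eps {f : ι → ℝ} (hf : f =O[l] fun _ => (1 : ℝ)) :
    (fun i => ε i * f i) =O[l] ε := by
  simpa using (isBigO_refl ε l).mul hf

/-- Divide X² - D² by X + D ≥ ε, then X - D by D ≥ ε. -/
theorem sub_isBigO_of_sq_sub (hε : Tendsto ε l (𝓝[>] 0)) {X D : ι → ℝ}
    (hX : ∀ᶠ i in l, ε i ≤ X i) (hD : ∀ᶠ i in l, ε i ≤ D i)
    (h : (fun i => X i ^ 2 - D i ^ 2) =O[l] fun i => ε i ^ 4) :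
    (fun i => X i - D i) =O[l] (fun i => ε i ^ 3) ∧
      (fun i => X i / D i - 1) =O[l] fun i => ε i ^ 2 := by
  have h1 : (fun i => X i - D i) =O[l] (fun i => ε i ^ 3) := by
    refine isBigO_pow_of_mul (m := 1) hε (IsBigO.trans (IsBigO.of_bound 1 ?_) h)
    filter_upwards [hX, hD, hε.eventually self_mem_nhdsWithin] with i h1 h2 h0
    have h0 : 0 < ε i := h0
    rw [norm_mul, one_mul, sq_sub_sq, norm_mul, pow_one, norm_eq_abs (ε i),
      norm_eq_abs (X i + D i), abs_of_pos h0, abs_of_pos (by linarith : 0 < X i + D i)]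
    gcongr
    linarith
  refine ⟨h1, isBigO_pow_of_mul (m := 1) hε (IsBigO.trans (IsBigO.of_bound 1 ?_) h1)⟩
  filter_upwards [hD, hε.eventually self_mem_nhdsWithin] with i h2 h0
  have h0 : 0 < ε i := h0
  have hDi : 0 < D i := h0.trans_le h2
  have e : X i / D i - 1 = (X i - D i) / D i := by field_simp
  rw [e, norm_mul, one_mul, norm_div, pow_one, norm_eq_abs (ε i), norm_eq_abs (D i), abs_of_pos h0,
    abs_of_pos hDi, ← mul_div_assoc, div_le_iff₀ hDi, mul_comm]
  gcongr

theorem eventually_pos_lt_one (hε : Tendsto ε l (𝓝[>] 0)) : ∀ᶠ i in l, 0 < ε i ∧ ε i < 1 :=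
  hε.eventually (Ioo_mem_nhdsGT (one_pos : (0 : ℝ) < 1))

theorem eventually_le_mul_cosh (hε : Tendsto ε l (𝓝[>] 0)) (v : ι → ℝ) :
    ∀ᶠ i in l, ε i ≤ ε i * cosh (v i) :=
  (eventually_pos_lt_one hε).mono fun _ hi => le_mul_of_one_le_right hi.1.le (one_le_cosh _)

/-- With r = ε sinh v, the squares ε² cosh² v = r² + ε² and sin² r + ε² cos² r differ by r² - sin² r
+ ε² sin² r = O(ε⁴). The second estimate says that the derivative of the shift is 1 + O(ε²). -/
theorem spherical_sub_isBigO (hε : Tendsto ε l (𝓝[>] 0)) {v : ι → ℝ}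
    (hv : v =O[l] fun _ => (1 : ℝ)) :
    (fun i => ε i * cosh (v i) - √(sin (ε i * sinh (v i)) ^ 2 +
      ε i ^ 2 * cos (ε i * sinh (v i)) ^ 2)) =O[l] (fun i => ε i ^ 3) ∧
    (fun i => ε i * cosh (v i) / √(sin (ε i * sinh (v i)) ^ 2 +
      ε i ^ 2 * cos (ε i * sinh (v i)) ^ 2) - 1) =O[l] fun i => ε i ^ 2 := by
  have hε0 := tendsto_zero_of_nhdsGT hε
  have hr : (fun i => ε i * sinh (v i)) =O[l] ε :=
    mul_isBigO_eps (comp_isBigO_one continuous_sinh hv)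
  have h1 := comp_taylor_isBigO sin_isBigO hε0 hr
  have h3 := comp_taylor_isBigO sin_sub_isBigO_three hε0 hr
  simp only [pow_one] at h1
  refine sub_isBigO_of_sq_sub hε (eventually_le_mul_cosh hε v) ?_ ?_
  · filter_upwards [eventually_pos_lt_one hε] with i hi
    refine le_sqrt_of_sq_le ?_
    nlinarith [sin_sq_add_cos_sq (ε i * sinh (v i)), sq_nonneg (sin (ε i * sinh (v i))),
      mul_nonneg (by nlinarith : 0 ≤ 1 - ε i ^ 2) (sq_nonneg (sin (ε i * sinh (v i))))]
  · have ha := (h3.mul (h1.add hr)).neg_left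
    have hb := (isBigO_refl (fun i => ε i ^ 2) l).mul (h1.mul h1)
    refine ((ha.congr_right fun i => (pow_succ (ε i) 3).symm).add
      (hb.congr_right fun i => by ring)).congr_left fun i => ?_
    rw [sq_sqrt (by positivity)]
    linear_combination (-ε i ^ 2) * cosh_sq (v i) +
      ε i ^ 2 * sin_sq_add_cos_sq (ε i * sinh (v i))

theorem hyperbolic_sub_isBigO (hε : Tendsto ε l (𝓝[>] 0)) {v : ι → ℝ}
    (hv : v =O[l] fun _ => (1 : ℝ)) :
    (fun i => ε i * cosh (v i) - √(sinh (ε i * sinh (v i)) ^ 2 + ε i ^ 2)) =O[l]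
      (fun i => ε i ^ 3) ∧
    (fun i => ε i * cosh (v i) / √(sinh (ε i * sinh (v i)) ^ 2 + ε i ^ 2) - 1) =O[l]
      fun i => ε i ^ 2 := by
  have hε0 := tendsto_zero_of_nhdsGT hε
  have hr : (fun i => ε i * sinh (v i)) =O[l] ε :=
    mul_isBigO_eps (comp_isBigO_one continuous_sinh hv)
  have h1 := comp_taylor_isBigO sinh_isBigO hε0 hr
  have h3 := comp_taylor_isBigO sinh_sub_isBigO_three hε0 hr
  simp only [pow_one] at h1
  refine sub_isBigO_of_sq_sub hε (eventually_le_mul_cosh hε v) ?_ ?_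
  · filter_upwards with i
    exact le_sqrt_of_sq_le (by nlinarith [sq_nonneg (sinh (ε i * sinh (v i)))])
  · have ha := (h3.mul (h1.add hr)).neg_left
    refine (ha.congr_right fun i => (pow_succ (ε i) 3).symm).congr_left fun i => ?_
    rw [sq_sqrt (by positivity)]
    linear_combination (-ε i ^ 2) * cosh_sq (v i)

/-- W - id has derivative O(ε²), uniformly on bounded sets, and is therefore Lipschitz with such a
constant. A mere bound W - id = O(ε²) would not control the sum of differences up to O(ε³). -/
theorem shift_sub_isBigO {W W' : ℝ → ℝ → ℝ}
    (hW : ∀ ε, 0 < ε → ε < 1 → ∀ v, HasDerivAt (W ε) (W' ε v) v)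
    (hW' : ∀ M : ℝ, (fun i : ℝ × ℝ => W' i.1 i.2 - 1) =O[𝓝[>] 0 ×ˢ 𝓟 {v | |v| ≤ M}]
      fun i => i.1 ^ 2) (hε : Tendsto ε l (𝓝[>] 0)) {x y : ι → ℝ}
    (hx : x =O[l] fun _ => (1 : ℝ)) (hy : y =O[l] fun _ => (1 : ℝ)) :
    (fun i => (W (ε i) (x i) - W (ε i) (y i)) - (x i - y i)) =O[l]
      fun i => ε i ^ 2 * (x i - y i) := by
  obtain ⟨M, hM⟩ := eventually_abs_le_of_isBigO_one hx
  obtain ⟨N, hN⟩ := eventually_abs_le_of_isBigO_one hy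
  obtain ⟨C, hC⟩ := (hW' (max M N)).bound
  rw [eventually_prod_principal_iff] at hC
  refine IsBigO.of_bound C ?_
  filter_upwards [hM, hN, hε.eventually hC, eventually_pos_lt_one hε] with i h1 h2 h3 h4
  have := abs_sub_le_of_hasDerivAt (f := fun v => W (ε i) v - v) (N := max M N)
    (fun v _ => (hW _ h4.1 h4.2 v).sub (hasDerivAt_id v)) (fun v hv => h3 v hv)
    (h1.trans (le_max_left _ _)) (h2.trans (le_max_right _ _))
  rw [norm_mul, ← mul_assoc]
  refine le_trans (le_of_eq ?_) this
  rw [norm_eq_abs]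
  congr 1
  ring

theorem principal_isBigO_one (M : ℝ) :
    (fun i : ℝ × ℝ => i.2) =O[𝓝[>] (0 : ℝ) ×ˢ 𝓟 {v | |v| ≤ M}] fun _ => (1 : ℝ) := by
  refine IsBigO.of_bound M ?_
  rw [eventually_prod_principal_iff]
  filter_upwards with ε v hv
  simpa using hv

theorem sphericalShift_sub_isBigO (hε : Tendsto ε l (𝓝[>] 0)) {x y : ι → ℝ}
    (hx : x =O[l] fun _ => (1 : ℝ)) (hy : y =O[l] fun _ => (1 : ℝ)) :
    (fun i => (sphericalShift (ε i) (x i) - sphericalShift (ε i) (y i)) - (x i - y i)) =O[l]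
      fun i => ε i ^ 2 * (x i - y i) :=
  shift_sub_isBigO (fun _ h0 h1 v => hasDerivAt_sphericalShift h0 h1 v)
    (fun M => (spherical_sub_isBigO tendsto_fst (principal_isBigO_one M)).2) hε hx hy

theorem hyperbolicShift_sub_isBigO (hε : Tendsto ε l (𝓝[>] 0)) {x y : ι → ℝ}
    (hx : x =O[l] fun _ => (1 : ℝ)) (hy : y =O[l] fun _ => (1 : ℝ)) :
    (fun i => (hyperbolicShift (ε i) (x i) - hyperbolicShift (ε i) (y i)) - (x i - y i)) =O[l]
      fun i => ε i ^ 2 * (x i - y i) :=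
  shift_sub_isBigO (fun _ h0 h1 v => hasDerivAt_hyperbolicShift h0 h1 v)
    (fun M => (hyperbolic_sub_isBigO tendsto_fst (principal_isBigO_one M)).2) hε hx hy

/-- Families of variables that differ from `v` by `ε ^ 2` times a Lipschitz function satisfy the
same expansions as `v`. -/
theorem shift_expansion (hε : Tendsto ε l (𝓝[>] 0)) {v w : ι → Fin 5 → ℝ} {σ : ℝ}
    (hv0 : (fun i => v i 0) =O[l] fun _ => (1 : ℝ))
    (hv : ∀ k : Fin 4, (fun i => v i k.succ - v i 0) =O[l] ε)
    (hs : (fun i => ∑ k : Fin 4, (v i k.succ - v i 0) + σ * (ε i ^ 2 * sinh (2 * v i 0))) =O[l]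
      fun i => ε i ^ 3)
    (hw0 : (fun i => w i 0 - v i 0) =O[l] fun i => ε i ^ 2)
    (hw : ∀ k : Fin 4, (fun i => (w i k.succ - w i 0) - (v i k.succ - v i 0)) =O[l]
      fun i => ε i ^ 2 * (v i k.succ - v i 0)) :
    (fun i => w i 0) =O[l] (fun _ => (1 : ℝ)) ∧
    (∀ k : Fin 4, (fun i => w i k.succ - w i 0) =O[l] ε) ∧
    (fun i => ∑ k : Fin 4, (w i k.succ - w i 0)) =O[l] (fun i => ε i ^ 2) ∧
    (fun i => ∑ k : Fin 4, (w i k.succ - w i 0) + σ * (ε i ^ 2 * sinh (2 * w i 0))) =O[l]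
      fun i => ε i ^ 3 := by
  have h1 : (fun i => w i 0) =O[l] fun _ => (1 : ℝ) :=
    ((isBigO_one_of_pow hε hw0).add hv0).congr_left fun i => by ring
  have h2 : ∀ k : Fin 4, (fun i => (w i k.succ - w i 0) - (v i k.succ - v i 0)) =O[l]
      fun i => ε i ^ 3 := fun k =>
    (hw k).trans (((isBigO_refl _ l).mul (hv k)).congr_right fun i => (pow_succ (ε i) 2).symm)
  have h3 : ∀ k : Fin 4, (fun i => w i k.succ - w i 0) =O[l] ε := fun k => by
    have := (h2 k).trans (pow_isBigO_pow hε (by norm_num : 1 ≤ 3))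
    simp only [pow_one] at this
    exact (this.add (hv k)).congr_left fun i => by ring
  have h4 : (fun i => sinh (2 * w i 0) - sinh (2 * v i 0)) =O[l] fun i => ε i ^ 1 :=
    (comp_sub_comp_isBigO hasDerivAt_sinh continuous_cosh (h1.const_mul_left 2)
      (hv0.const_mul_left 2)).trans (((hw0.const_mul_left 2).congr_left fun i => by ring).trans
        (pow_isBigO_pow hε (by norm_num)))
  have h5 : (fun i => ∑ k : Fin 4, (w i k.succ - w i 0) + σ * (ε i ^ 2 * sinh (2 * w i 0))) =O[l]
      fun i => ε i ^ 3 := by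
    have ha := (((h2 0).add (h2 1)).add (h2 2)).add (h2 3)
    have hb := (((isBigO_refl (fun i => ε i ^ 2) l).mul h4).congr_right
      fun i => (pow_add (ε i) 2 1).symm).const_mul_left σ
    refine ((ha.add hb).add hs).congr_left fun i => ?_
    simp only [Fin.sum_univ_four]
    ring
  have h6 : (fun i => ε i ^ 2 * sinh (2 * w i 0)) =O[l] fun i => ε i ^ 2 :=
    ((isBigO_refl (fun i => ε i ^ 2) l).mul
      (comp_isBigO_one continuous_sinh (h1.const_mul_left 2))).congr_right fun i => mul_one _
  exact ⟨h1, h3, ((h5.trans (pow_isBigO_pow hε (by norm_num))).sub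
    (h6.const_mul_left σ)).congr_left fun i => by ring, h5⟩

theorem isBigO_of_add_I_mul {P : ι → ℂ} {s : ι → ℝ}
    (hP : (fun i => P i + Complex.I * (s i : ℂ)) =O[l] fun i => ε i ^ 3)
    (hs : s =O[l] fun i => ε i ^ 3) : P =O[l] fun i => ε i ^ 3 := by
  have : (fun i => Complex.I * (s i : ℂ)) =O[l] fun i => ε i ^ 3 := by
    refine IsBigO.trans (IsBigO.of_bound 1 (.of_forall fun i => ?_)) hs
    rw [norm_mul, Complex.norm_real, Complex.norm_I]
  exact (hP.sub this).congr_left fun i => by ring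

theorem sphericalProd_isBigO (hε : Tendsto ε l (𝓝[>] 0)) {v : ι → Fin 5 → ℝ}
    (hv0 : (fun i => v i 0) =O[l] fun _ => (1 : ℝ))
    (hv : ∀ k : Fin 4, (fun i => v i k.succ - v i 0) =O[l] ε)
    (hs : (fun i => ∑ k : Fin 4, (v i k.succ - v i 0) + ε i ^ 2 * sinh (2 * v i 0)) =O[l]
      fun i => ε i ^ 3) :
    (fun i => sphericalProd √(1 - ε i ^ 2)
      (fun j => ellipticF √(1 - ε i ^ 2) (π / 2 - ε i * sinh (v i j))) - 1) =O[l]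
        fun i => ε i ^ 3 := by
  have hε1 := (tendsto_zero_of_nhdsGT hε).isBigO_one ℝ
  have hvk : ∀ k : Fin 4, (fun i => v i k.succ) =O[l] fun _ => (1 : ℝ) := fun k =>
    (((hv k).trans hε1).add hv0).congr_left fun i => by ring
  -- The shift vanishes at 0, so comparing the central value with 0 bounds its displacement by
  -- O(ε²).
  obtain ⟨h1, h2, h3, h4⟩ := shift_expansion (σ := 1) hε hv0 hv (by simpa using hs)
    (w := fun i j => sphericalShift (ε i) (v i j))
    (((sphericalShift_sub_isBigO hε hv0 (isBigO_zero _ _)).congr_left fun i => by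
      rw [sphericalShift_zero]; ring).trans (by
        simpa using (isBigO_refl (fun i => ε i ^ 2) l).mul hv0))
    (fun k => sphericalShift_sub_isBigO hε (hvk k) hv0)
  refine isBigO_of_add_I_mul ((ringProd_sub_isBigO hε
    (w := fun i j => sphericalShift (ε i) (v i j)) h1 h2 h3).1.congr_left fun i => ?_)
    (h4.congr_left fun i => by rw [one_mul])
  simp only [sphericalShift, sub_sub_cancel]

theorem hyperbolicProd_isBigO (hε : Tendsto ε l (𝓝[>] 0)) {v : ι → Fin 5 → ℝ}
    (hv0 : (fun i => v i 0) =O[l] fun _ => (1 : ℝ))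
    (hv : ∀ k : Fin 4, (fun i => v i k.succ - v i 0) =O[l] ε)
    (hs : (fun i => ∑ k : Fin 4, (v i k.succ - v i 0) - ε i ^ 2 * sinh (2 * v i 0)) =O[l]
      fun i => ε i ^ 3) :
    (fun i => hyperbolicProd √(1 - ε i ^ 2)
      (fun j => ellipticF √(1 - ε i ^ 2) (π / 2 - arctan (sinh (ε i * sinh (v i j))))) - 1) =O[l]
        fun i => ε i ^ 3 := by
  have hε1 := (tendsto_zero_of_nhdsGT hε).isBigO_one ℝ
  have hvk : ∀ k : Fin 4, (fun i => v i k.succ) =O[l] fun _ => (1 : ℝ) := fun k =>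
    (((hv k).trans hε1).add hv0).congr_left fun i => by ring
  obtain ⟨h1, h2, h3, h4⟩ := shift_expansion (σ := -1) hε hv0 hv
    (hs.congr_left fun i => by ring)
    (w := fun i j => hyperbolicShift (ε i) (v i j))
    (((hyperbolicShift_sub_isBigO hε hv0 (isBigO_zero _ _)).congr_left fun i => by
      rw [hyperbolicShift_zero]; ring).trans (by
        simpa using (isBigO_refl (fun i => ε i ^ 2) l).mul hv0))
    (fun k => hyperbolicShift_sub_isBigO hε (hvk k) hv0)
  refine isBigO_of_add_I_mul ((ringProd_sub_isBigO hε
    (w := fun i j => hyperbolicShift (ε i) (v i j)) h1 h2 h3).2.congr_left fun i => ?_)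
    (h4.congr_left fun i => by rw [neg_one_mul, ← sub_eq_add_neg])
  simp only [hyperbolicShift, sub_sub_cancel]

/-! ### Outer radii -/

theorem sin_sub_dn_isBigO (hε : Tendsto ε l (𝓝[>] 0)) {v : ι → ℝ}
    (hv : v =O[l] fun _ => (1 : ℝ)) :
    (fun i => sin (ε i * cosh (v i)) -
      dn √(1 - ε i ^ 2) (ellipticF √(1 - ε i ^ 2) (π / 2 - ε i * sinh (v i)))) =O[l]
        fun i => ε i ^ 3 := by
  have hR : (fun i => ε i * cosh (v i)) =O[l] ε :=
    mul_isBigO_eps (comp_isBigO_one continuous_cosh hv)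
  refine ((comp_taylor_isBigO sin_sub_isBigO_three (tendsto_zero_of_nhdsGT hε) hR).add
    (spherical_sub_isBigO hε hv).1).congr' ?_ .rfl
  filter_upwards [eventually_pos_lt_one hε] with i hi
  rw [dn_ellipticF_pi_div_two_sub hi.1 hi.2]
  ring

theorem tanh_sub_dn_isBigO (hε : Tendsto ε l (𝓝[>] 0)) {v : ι → ℝ}
    (hv : v =O[l] fun _ => (1 : ℝ)) :
    (fun i => tanh (ε i * cosh (v i)) -
      dn √(1 - ε i ^ 2) (ellipticF √(1 - ε i ^ 2)
        (π / 2 - arctan (sinh (ε i * sinh (v i)))))) =O[l] fun i => ε i ^ 3 := by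
  have hε0 := tendsto_zero_of_nhdsGT hε
  have hR : (fun i => ε i * cosh (v i)) =O[l] ε :=
    mul_isBigO_eps (comp_isBigO_one continuous_cosh hv)
  have hr : (fun i => ε i * sinh (v i)) =O[l] ε :=
    mul_isBigO_eps (comp_isBigO_one continuous_sinh hv)
  have h1 := (comp_taylor_isBigO tanh_sub_isBigO_five hε0 hR).trans
    (pow_isBigO_pow hε (by norm_num : 3 ≤ 5))
  have h2 := (hR.pow 3).const_mul_left (1 / 3)
  have h3 := (hyperbolic_sub_isBigO hε hv).1
  have hD : (fun i => √(sinh (ε i * sinh (v i)) ^ 2 + ε i ^ 2)) =O[l] ε := by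
    have := h3.trans (pow_isBigO_pow hε (by norm_num : 1 ≤ 3))
    simp only [pow_one] at this
    exact (hR.sub this).congr_left fun i => by ring
  have hinv : (fun i => 1 / cosh (ε i * sinh (v i))) =O[l] fun _ => (1 : ℝ) :=
    comp_isBigO_one (continuous_const.div continuous_cosh fun x => (cosh_pos x).ne')
      (hr.trans (hε0.isBigO_one ℝ))
  have h4 := (hD.mul (comp_taylor_isBigO cosh_sub_isBigO_two hε0 hr)).mul hinv
  refine (((h1.sub h2).add h3).add (h4.congr_right fun i => by ring)).congr' ?_ .rfl
  filter_upwards [eventually_pos_lt_one hε] with i hi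
  rw [dn_ellipticF_pi_div_two_sub hi.1 hi.2, sin_sq_add_gudermann]
  have := (cosh_pos (ε i * sinh (v i))).ne'
  field_simp
  ring

/-- Here sn γ = 1/cosh r, and q cosh R - cosh r has second-order part (R² - r²)/2 - ε²/2 = 0; the
error is in fact O(ε⁴). -/
theorem cosh_sub_sn_isBigO (hε : Tendsto ε l (𝓝[>] 0)) {v : ι → ℝ}
    (hv : v =O[l] fun _ => (1 : ℝ)) :
    (fun i => cosh (ε i * cosh (v i)) -
      1 / (√(1 - ε i ^ 2) * sn √(1 - ε i ^ 2) (ellipticF √(1 - ε i ^ 2)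
        (π / 2 - arctan (sinh (ε i * sinh (v i))))))) =O[l] fun i => ε i ^ 3 := by
  have hε0 := tendsto_zero_of_nhdsGT hε
  have hR : (fun i => ε i * cosh (v i)) =O[l] ε :=
    mul_isBigO_eps (comp_isBigO_one continuous_cosh hv)
  have hr : (fun i => ε i * sinh (v i)) =O[l] ε :=
    mul_isBigO_eps (comp_isBigO_one continuous_sinh hv)
  have h1 := comp_taylor_isBigO cosh_sub_isBigO_four hε0 hR
  have h2 := comp_taylor_isBigO cosh_sub_isBigO_four hε0 hr
  have h3 := one_sub_modulus_sub_isBigO hε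
  have h4 := ((one_sub_modulus_isBigO hε).mul
    (comp_taylor_isBigO cosh_sub_isBigO_two hε0 hR)).congr_right fun i =>
      (pow_add (ε i) 2 2).symm
  have hq : Tendsto (fun i => √(1 - ε i ^ 2)) l (𝓝 1) := by
    have := ((hε0.pow 2).const_sub 1).sqrt
    simpa using this
  have h5 := (((h1.sub h2).sub h3).sub h4).mul ((hq.inv₀ one_ne_zero).isBigO_one ℝ)
  refine ((h5.congr_right fun i => mul_one _).trans
    (pow_isBigO_pow hε (by norm_num : 3 ≤ 4))).congr' ?_ .rfl
  filter_upwards [eventually_pos_lt_one hε] with i hi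
  have hk : √(1 - ε i ^ 2) ≠ 0 := (sqrt_pos.2 (by nlinarith)).ne'
  have hc := (cosh_pos (ε i * sinh (v i))).ne'
  rw [sn, am_ellipticF (sq_modulus_lt_one hi.1 hi.2), sin_pi_div_two_sub, cos_arctan, ← cosh_sq',
    sqrt_sq (cosh_pos _).le]
  field_simp
  linear_combination (-ε i ^ 2) * cosh_sq (v i)

end families

/-! ### Infinitesimal flowers -/

theorem arctan_div_sub_arctan_div {a b c d : ℝ} (hb : 0 < b) (hd : 0 < d)
    (h : 0 < b * d + a * c) :
    arctan (a / b) - arctan (c / d) = arctan ((a * d - b * c) / (b * d + a * c)) := by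
  have h1 : a / b * -(c / d) < 1 := by
    rw [← neg_div, div_mul_div_comm, div_lt_one (mul_pos hb hd)]
    linarith
  rw [sub_eq_add_neg, ← arctan_neg, arctan_add h1]
  congr 1
  have h2 : 1 - a / b * -(c / d) = (b * d + a * c) / (b * d) := by field_simp; ring
  rw [h2]
  field_simp
  ring

/-- In the upper half-plane this form of the argument is smooth across x = 0, so the angle
expansions need no case distinction on the sign of r. -/
theorem arg_mk_of_pos {x y : ℝ} (hy : 0 < y) : Complex.arg ⟨x, y⟩ = π / 2 - arctan (x / y) := by
  have h1 := arctan_lt_pi_div_two (x / y)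
  have h2 := neg_pi_div_two_lt_arctan (x / y)
  have hs : 0 < √(1 + (x / y) ^ 2) := sqrt_pos.2 (by positivity)
  have h := Complex.arg_mul_cos_add_sin_mul_I (r := y * √(1 + (x / y) ^ 2))
    (θ := π / 2 - arctan (x / y)) (by positivity) ⟨by linarith, by linarith⟩
  rw [← h]
  congr 1
  rw [← Complex.ofReal_cos, ← Complex.ofReal_sin, cos_pi_div_two_sub, sin_pi_div_two_sub,
    sin_arctan, cos_arctan]
  apply Complex.ext
  · simp
    field_simp
  · simp
    field_simp

theorem abs_sinh_lt_cosh (v : ℝ) : |sinh v| < cosh v :=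
  abs_lt_of_sq_lt_sq (by rw [cosh_sq]; linarith) (cosh_pos v).le

section families

variable {ι : Type*} {l : Filter ι} {ε : ι → ℝ}

theorem mul_sub_mul_isBigO {f f₀ g g₀ : ι → ℝ} {m n : ℕ}
    (hf : (fun i => f i - f₀ i) =O[l] fun i => ε i ^ n)
    (hg : (fun i => g i - g₀ i) =O[l] fun i => ε i ^ n)
    (hf₀ : f₀ =O[l] fun i => ε i ^ m) (hg' : g =O[l] fun i => ε i ^ m) :
    (fun i => f i * g i - f₀ i * g₀ i) =O[l] fun i => ε i ^ (n + m) :=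
  ((hf.mul hg').congr_right fun i => (pow_add (ε i) n m).symm).add
    ((hf₀.mul hg).congr_right fun i => by rw [← pow_add, add_comm]) |>.congr_left fun i => by ring

/-- Supplies the lower bounds that make denominators positive and divisible out. -/
theorem eventually_half_le (hε : Tendsto ε l (𝓝[>] 0)) {f g : ι → ℝ} {n : ℕ}
    (h : (fun i => f i - g i) =O[l] fun i => ε i ^ (n + 1))
    (hg : ∀ i, 0 < ε i → ε i ^ n ≤ g i) : ∀ᶠ i in l, ε i ^ n / 2 ≤ f i := by
  obtain ⟨C, hC0, hC⟩ := h.exists_pos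
  have hsmall : ∀ᶠ i in l, C * ε i < 1 / 2 := by
    have := (tendsto_zero_of_nhdsGT hε).const_mul C
    rw [mul_zero] at this
    exact this.eventually_lt_const (by norm_num)
  filter_upwards [hC.bound, hsmall, eventually_pos_lt_one hε] with i h1 h2 h3
  have hp := pow_pos h3.1 n
  rw [norm_eq_abs, norm_eq_abs, abs_of_pos (pow_pos h3.1 _), pow_succ] at h1
  have h4 := (abs_le.1 h1).1
  have h5 := hg i h3.1
  nlinarith

/-- Let g(X) be the quadratic polynomial in X = x² approximating c. With h = ε², X = r², Y = r'²,
the expression g(X+h)g(Y) - g(X)g(Y+h) is divisible by h and, being antisymmetric in X and Y, by X -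
Y = O(ε³). -/
theorem orthogonality_isBigO (hε : Tendsto ε l (𝓝[>] 0)) {c : ℝ → ℝ} {σ : ℝ}
    (hc : (fun x => c x - (1 - σ * x ^ 2 / 2 + x ^ 4 / 24)) =O[𝓝 0] fun x => x ^ 6)
    {v v' : ι → ℝ} (hv : v =O[l] fun _ => (1 : ℝ)) (hv' : (fun i => v' i - v i) =O[l] ε) :
    (fun i => c (ε i * cosh (v i)) * c (ε i * sinh (v' i)) -
      c (ε i * sinh (v i)) * c (ε i * cosh (v' i))) =O[l] fun i => ε i ^ 5 := by
  have hε0 := tendsto_zero_of_nhdsGT hε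
  have hε1 := hε0.isBigO_one ℝ
  have hv'1 : v' =O[l] fun _ => (1 : ℝ) := ((hv'.trans hε1).add hv).congr_left fun i => by ring
  have key : ∀ x : ι → ℝ, x =O[l] (fun _ => (1 : ℝ)) →
      (fun i => c (ε i * x i) - (1 - σ * (ε i * x i) ^ 2 / 2 + (ε i * x i) ^ 4 / 24)) =O[l]
        (fun i => ε i ^ 6) ∧
      (fun i => 1 - σ * (ε i * x i) ^ 2 / 2 + (ε i * x i) ^ 4 / 24) =O[l] (fun i => ε i ^ 0) ∧
      (fun i => c (ε i * x i)) =O[l] fun i => ε i ^ 0 := by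
    intro x hx
    have h1 := comp_taylor_isBigO hc hε0 (mul_isBigO_eps hx)
    have h2 : (fun i => 1 - σ * (ε i * x i) ^ 2 / 2 + (ε i * x i) ^ 4 / 24) =O[l]
        (fun i => ε i ^ 0) := by
      simpa using comp_isBigO_one (f := fun y => 1 - σ * y ^ 2 / 2 + y ^ 4 / 24) (by fun_prop)
        ((mul_isBigO_eps hx).trans hε1)
    exact ⟨h1, h2, ((h1.trans (pow_isBigO_pow hε (by norm_num))).add h2).congr_left
      fun i => by ring⟩
  have hs := comp_isBigO_one continuous_sinh hv
  have hs' := comp_isBigO_one continuous_sinh hv'1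
  obtain ⟨a1, a2, a3⟩ := key _ hs
  obtain ⟨b1, b2, b3⟩ := key _ hs'
  obtain ⟨c1, c2, c3⟩ := key _ (comp_isBigO_one continuous_cosh hv)
  obtain ⟨d1, d2, d3⟩ := key _ (comp_isBigO_one continuous_cosh hv'1)
  have h1 := mul_sub_mul_isBigO c1 b1 c2 b3
  have h2 := mul_sub_mul_isBigO a1 d1 a2 d3
  have h3 : (fun i => sinh (v i) ^ 2 - sinh (v' i) ^ 2) =O[l] fun i => ε i := by
    have := comp_sub_comp_isBigO (f := fun x => sinh x ^ 2) (f' := fun x => 2 * sinh x * cosh x)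
      (fun x => by simpa using (hasDerivAt_sinh x).fun_pow 2)
      (by fun_prop) hv hv'1
    exact this.trans (hv'.neg_left.congr_left fun i => by ring)
  -- The bounded cofactor of h(X - Y): for g = 1 + aX + bX² it is 2b(1 - bXY) - (a + bh)(a + b(X +
  -- Y)), with a = -σ/2 and b = 1/24.
  have h4 : (fun i => 2 * (1 / 24) * (1 - 1 / 24 * (ε i * sinh (v i)) ^ 2 *
      (ε i * sinh (v' i)) ^ 2) - (-σ / 2 + 1 / 24 * ε i ^ 2) *
      (-σ / 2 + 1 / 24 * ((ε i * sinh (v i)) ^ 2 + (ε i * sinh (v' i)) ^ 2))) =O[l]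
        fun _ => (1 : ℝ) := by
    have o : (fun _ : ι => (1 : ℝ)) =O[l] fun _ => (1 : ℝ) := isBigO_refl _ _
    have e2 : (fun i => ε i ^ 2) =O[l] fun _ => (1 : ℝ) := by simpa using hε1.pow 2
    have x2 : (fun i => (ε i * sinh (v i)) ^ 2) =O[l] fun _ => (1 : ℝ) := by
      simpa using (hε1.mul hs).pow 2
    have y2 : (fun i => (ε i * sinh (v' i)) ^ 2) =O[l] fun _ => (1 : ℝ) := by
      simpa using (hε1.mul hs').pow 2
    have m1 := (o.sub (((x2.mul y2).congr_right fun _ => mul_one _).const_mul_left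
      (1 / 24))).const_mul_left (2 * (1 / 24))
    have m2 := (((o.const_mul_left (-σ / 2)).add (e2.const_mul_left (1 / 24))).mul
      ((o.const_mul_left (-σ / 2)).add ((x2.add y2).const_mul_left (1 / 24)))).congr_right
        fun _ => mul_one _
    exact (m1.sub m2).congr_left fun i => by ring
  have h5 := (((isBigO_refl (fun i => ε i ^ 4) l).mul h3).mul h4).congr_right
    (g₂ := fun i => ε i ^ 5) fun i => by ring
  refine (((h1.sub h2).trans (pow_isBigO_pow hε (by norm_num))).add h5).congr_left fun i => ?_
  have e1 := cosh_sq (v i)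
  have e2 := cosh_sq (v' i)
  have e3 : cosh (v i) ^ 4 = (sinh (v i) ^ 2 + 1) ^ 2 := by rw [← e1]; ring
  have e4 : cosh (v' i) ^ 4 = (sinh (v' i) ^ 2 + 1) ^ 2 := by rw [← e2]; ring
  simp only [mul_pow, e1, e2, e3, e4]
  ring

/-- The expansion of the opening angles, for `S = sin`, `T = tan` and `S = sinh`, `T = tanh`. -/
theorem angle_isBigO (hε : Tendsto ε l (𝓝[>] 0)) {S T : ℝ → ℝ} {σ : ℝ}
    (hS : (fun x => S x - (x - σ * x ^ 3 / 6)) =O[𝓝 0] fun x => x ^ 5)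
    (hT : (fun x => T x - (x + σ * x ^ 3 / 3)) =O[𝓝 0] fun x => x ^ 5)
    {v v' : ι → ℝ} (hv : v =O[l] fun _ => (1 : ℝ)) (hv' : (fun i => v' i - v i) =O[l] ε) :
    (∀ᶠ i in l, 0 < T (ε i * cosh (v' i))) ∧
    (fun i => arctan (T (ε i * sinh (v' i)) / S (ε i * cosh (v i))) -
      arctan (S (ε i * sinh (v i)) / T (ε i * cosh (v' i))) -
      ((v' i - v i) + σ * (ε i ^ 2 * sinh (2 * v i)) / 4)) =O[l] fun i => ε i ^ 3 := by
  have hε0 := tendsto_zero_of_nhdsGT hε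
  have hε1 := hε0.isBigO_one ℝ
  have hv'1 : v' =O[l] fun _ => (1 : ℝ) := ((hv'.trans hε1).add hv).congr_left fun i => by ring
  have key : ∀ (f : ℝ → ℝ) (τ : ℝ), ((fun x => f x - (x + τ * x ^ 3)) =O[𝓝 0] fun x => x ^ 5) →
      ∀ x : ι → ℝ, x =O[l] (fun _ => (1 : ℝ)) →
      (fun i => f (ε i * x i) - (ε i * x i + τ * (ε i * x i) ^ 3)) =O[l] (fun i => ε i ^ 5) ∧
      (fun i => ε i * x i + τ * (ε i * x i) ^ 3) =O[l] (fun i => ε i ^ 1) ∧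
      (fun i => f (ε i * x i)) =O[l] (fun i => ε i ^ 1) ∧
      (fun i => f (ε i * x i) - ε i * x i) =O[l] (fun i => ε i ^ 3) := by
    intro f τ hf x hx
    have h0 := mul_isBigO_eps hx (ε := ε)
    have h1 := comp_taylor_isBigO hf hε0 h0
    have h2 := (h0.pow 3).const_mul_left τ
    have h3 : (fun i => ε i * x i + τ * (ε i * x i) ^ 3) =O[l] (fun i => ε i ^ 1) :=
      (h0.congr_right fun i => (pow_one _).symm).add (h2.trans (pow_isBigO_pow hε (by norm_num)))
    exact ⟨h1, h3, ((h1.trans (pow_isBigO_pow hε (by norm_num))).add h3).congr_left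
      fun i => by ring, ((h1.trans (pow_isBigO_pow hε (by norm_num))).add h2).congr_left
      fun i => by ring⟩
  have hS' : (fun x => S x - (x + (-σ / 6) * x ^ 3)) =O[𝓝 0] fun x => x ^ 5 :=
    hS.congr_left fun x => by ring
  have hT' : (fun x => T x - (x + (σ / 3) * x ^ 3)) =O[𝓝 0] fun x => x ^ 5 :=
    hT.congr_left fun x => by ring
  have hs := comp_isBigO_one continuous_sinh hv
  have hs' := comp_isBigO_one continuous_sinh hv'1
  have hc := comp_isBigO_one continuous_cosh hv
  have hc' := comp_isBigO_one continuous_cosh hv'1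
  obtain ⟨a1, a2, a3, a4⟩ := key T _ hT' _ hs'
  obtain ⟨b1, b2, b3, b4⟩ := key S _ hS' _ hc
  obtain ⟨c1, c2, c3, c4⟩ := key S _ hS' _ hs
  obtain ⟨d1, d2, d3, d4⟩ := key T _ hT' _ hc'
  have hBpos := eventually_half_le (n := 1) hε (b4.trans (pow_isBigO_pow hε (by norm_num)))
    (fun i hi => by rw [pow_one]; exact le_mul_of_one_le_right hi.le (one_le_cosh _))
  have hDpos := eventually_half_le (n := 1) hε (d4.trans (pow_isBigO_pow hε (by norm_num)))
    (fun i hi => by rw [pow_one]; exact le_mul_of_one_le_right hi.le (one_le_cosh _))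
  have hsc : ∀ {x : ι → ℝ}, x =O[l] (fun _ => (1 : ℝ)) →
      (fun i => ε i * x i) =O[l] fun i => ε i ^ 1 := fun hx => by
    simpa using mul_isBigO_eps hx
  -- the denominator
  have hQ : (fun i => S (ε i * cosh (v i)) * T (ε i * cosh (v' i)) +
      T (ε i * sinh (v' i)) * S (ε i * sinh (v i)) - ε i ^ 2 * cosh (v i + v' i)) =O[l]
        fun i => ε i ^ 4 := by
    refine ((mul_sub_mul_isBigO b4 d4 (hsc hc) d3).add
      (mul_sub_mul_isBigO a4 c4 (hsc hs') c3)).congr_left fun i => ?_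
    rw [cosh_add]
    ring
  have hQpos := eventually_half_le (n := 2) hε (hQ.trans (pow_isBigO_pow hε (by norm_num)))
    (fun i hi => le_mul_of_one_le_right (sq_nonneg _) (one_le_cosh _))
  -- the numerator
  have hN1 := mul_sub_mul_isBigO a1 d1 a2 d3
  have hN2 := mul_sub_mul_isBigO b1 c1 b2 c3
  -- The products of two cubic corrections, the only terms of order ε⁶ in the product of the cubic
  -- polynomials.
  have hrem : (fun i => ε i ^ 6 * ((σ / 3) ^ 2 * (sinh (v' i) * cosh (v' i)) ^ 3 -
      (σ / 6) ^ 2 * (sinh (v i) * cosh (v i)) ^ 3)) =O[l] fun i => ε i ^ 6 := by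
    have m1 := ((hs'.mul hc').pow 3).const_mul_left ((σ / 3) ^ 2)
    have m2 := ((hs.mul hc).pow 3).const_mul_left ((σ / 6) ^ 2)
    simpa using (isBigO_refl (fun i => ε i ^ 6) l).mul (m1.sub m2)
  have ha : (fun i => v' i - v i) =O[l] fun i => ε i ^ 1 := by simpa using hv'
  have hsinh : (fun i => sinh (v' i - v i)) =O[l] fun i => ε i ^ 1 :=
    comp_taylor_isBigO sinh_isBigO hε0 hv'
  have hs2 : (fun i => sinh (2 * v i)) =O[l] fun _ => (1 : ℝ) :=
    comp_isBigO_one continuous_sinh (hv.const_mul_left 2)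
  -- The ε⁴ coefficient of numerator minus lead times denominator. It vanishes for v' = v because
  -- 1/3 + 1/6 = 1/2 and sinh² + cosh² = cosh(2v), so it is O(ε); this fixes the coefficient σ/4.
  have hLip : (fun i => σ * (sinh (v' i) * cosh (v' i) * (sinh (v' i) ^ 2 + cosh (v' i) ^ 2) / 3 +
      sinh (v i) * cosh (v i) * (sinh (v i) ^ 2 + cosh (v i) ^ 2) / 6 -
      sinh (v i) * cosh (v i) / 2 * cosh (v i + v' i))) =O[l] fun i => ε i ^ 1 := by
    have d1 := comp_sub_comp_isBigO
      (f := fun x => sinh x * cosh x * (sinh x ^ 2 + cosh x ^ 2))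
      (f' := fun x => (cosh x * cosh x + sinh x * sinh x) * (sinh x ^ 2 + cosh x ^ 2) +
        sinh x * cosh x * (2 * sinh x * cosh x + 2 * cosh x * sinh x))
      (fun x => by
        simpa using ((hasDerivAt_sinh x).fun_mul (hasDerivAt_cosh x)).fun_mul
          (((hasDerivAt_sinh x).fun_pow 2).fun_add ((hasDerivAt_cosh x).fun_pow 2))) (by fun_prop) hv'1 hv
    have d2 := comp_sub_comp_isBigO hasDerivAt_cosh continuous_sinh (hv.add hv'1) (hv.add hv)
    have d2' := d2.trans (ha.congr_left fun i => by ring)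
    have d3 := ((hs.mul hc).mul d2').congr_right fun i => by rw [mul_one, one_mul]
    refine ((((d1.trans ha).const_mul_left (1 / 3)).sub (d3.const_mul_left (1 / 2))).const_mul_left
      σ).congr_left fun i => ?_
    rw [cosh_add (v i) (v i)]
    ring
  have hN : (fun i => T (ε i * sinh (v' i)) * T (ε i * cosh (v' i)) -
      S (ε i * cosh (v i)) * S (ε i * sinh (v i)) -
      (sinh (v' i - v i) + σ * (ε i ^ 2 * sinh (2 * v i)) / 4) *
        (S (ε i * cosh (v i)) * T (ε i * cosh (v' i)) +
          T (ε i * sinh (v' i)) * S (ε i * sinh (v i)))) =O[l] fun i => ε i ^ 5 := by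
    have m1 := ((hN1.sub hN2).add hrem).trans (pow_isBigO_pow hε (by norm_num : 5 ≤ 6))
    have m2 := (((isBigO_refl (fun i => ε i ^ 4) l).mul hLip)).congr_right
      fun i => (pow_add (ε i) 4 1).symm
    have m3 := (hsinh.mul hQ).congr_right fun i => (pow_add (ε i) 1 4).symm
    have m4 := ((((isBigO_refl (fun i => ε i ^ 2) l).mul hs2).mul hQ).congr_right
      (g₂ := fun i => ε i ^ 6) fun i => by ring).trans (pow_isBigO_pow hε (by norm_num : 5 ≤ 6))
    refine (((m1.add m2).sub m3).sub (m4.const_mul_left (σ / 4))).congr_left fun i => ?_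
    -- The leading numerator is divisible by the leading denominator cosh(v + v'), with quotient
    -- sinh(v' - v).
    have e1 : sinh (v' i - v i) * cosh (v i + v' i)
        = sinh (v' i) * cosh (v' i) - sinh (v i) * cosh (v i) := by
      rw [sinh_sub, cosh_add]
      linear_combination (sinh (v' i) * cosh (v' i)) * cosh_sq (v i)
        - (sinh (v i) * cosh (v i)) * cosh_sq (v' i)
    rw [sinh_two_mul]
    linear_combination (ε i ^ 2) * e1
  have hquot : (fun i => (T (ε i * sinh (v' i)) * T (ε i * cosh (v' i)) -
      S (ε i * cosh (v i)) * S (ε i * sinh (v i))) /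
        (S (ε i * cosh (v i)) * T (ε i * cosh (v' i)) +
          T (ε i * sinh (v' i)) * S (ε i * sinh (v i))) -
      (sinh (v' i - v i) + σ * (ε i ^ 2 * sinh (2 * v i)) / 4)) =O[l] fun i => ε i ^ 3 := by
    -- The factor 2 comes from the lower bound Q ≥ ε²/2.
    refine isBigO_pow_of_mul (m := 2) hε (IsBigO.trans (IsBigO.of_bound 2 ?_) hN)
    filter_upwards [hQpos, eventually_pos_lt_one hε] with i h1 h2
    have hp := pow_pos h2.1 2
    set Q := S (ε i * cosh (v i)) * T (ε i * cosh (v' i)) +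
      T (ε i * sinh (v' i)) * S (ε i * sinh (v i))
    have hQ0 : 0 < Q := by linarith
    rw [div_sub' hQ0.ne', norm_mul, norm_div, norm_eq_abs (ε i ^ 2), norm_eq_abs Q, abs_of_pos hp,
      abs_of_pos hQ0, ← mul_div_assoc, div_le_iff₀ hQ0, mul_comm Q]
    nlinarith [norm_nonneg (T (ε i * sinh (v' i)) * T (ε i * cosh (v' i)) -
      S (ε i * cosh (v i)) * S (ε i * sinh (v i)) -
      (sinh (v' i - v i) + σ * (ε i ^ 2 * sinh (2 * v i)) / 4) * Q)]
  have hmain : (fun i => sinh (v' i - v i) + σ * (ε i ^ 2 * sinh (2 * v i)) / 4 -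
      ((v' i - v i) + σ * (ε i ^ 2 * sinh (2 * v i)) / 4)) =O[l] fun i => ε i ^ 3 :=
    (comp_taylor_isBigO sinh_sub_isBigO_three hε0 hv').congr_left fun i => by ring
  have hlead : (fun i => sinh (v' i - v i) + σ * (ε i ^ 2 * sinh (2 * v i)) / 4) =O[l]
      fun i => ε i ^ 1 := by
    have := (((isBigO_refl (fun i => ε i ^ 2) l).mul hs2).congr_right fun i => mul_one _).trans
      (pow_isBigO_pow hε (by norm_num : 1 ≤ 2))
    exact (hsinh.add (this.const_mul_left (σ / 4))).congr_left fun i => by ring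
  have hquot1 := (hquot.trans (pow_isBigO_pow hε (by norm_num : 1 ≤ 3))).add hlead
  simp only [sub_add_cancel, pow_one] at hquot1
  refine ⟨?_, (((comp_taylor_isBigO arctan_sub_isBigO_three hε0 hquot1).add hquot).add
    hmain).congr' ?_ .rfl⟩
  · filter_upwards [hDpos, eventually_pos_lt_one hε] with i h1 h2
    linarith [pow_pos h2.1 1]
  · filter_upwards [hBpos, hDpos, hQpos, eventually_pos_lt_one hε] with i h1 h2 h3 h4
    rw [arctan_div_sub_arctan_div (by linarith [pow_pos h4.1 1]) (by linarith [pow_pos h4.1 1])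
      (by linarith [pow_pos h4.1 2])]
    ring

/-- Each angle is π/2, or -π/2 for r < 0, plus the difference expanded in `angle_isBigO`; the four
constants make ±2π, and the four differences sum to the left side of `hs`. -/
theorem angle_sum_isBigO (hε : Tendsto ε l (𝓝[>] 0)) {S T : ℝ → ℝ} {σ : ℝ}
    (hS : (fun x => S x - (x - σ * x ^ 3 / 6)) =O[𝓝 0] fun x => x ^ 5)
    (hT : (fun x => T x - (x + σ * x ^ 3 / 3)) =O[𝓝 0] fun x => x ^ 5)
    {v : ι → Fin 5 → ℝ} (hv0 : (fun i => v i 0) =O[l] fun _ => (1 : ℝ))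
    (hv : ∀ k : Fin 4, (fun i => v i k.succ - v i 0) =O[l] ε)
    (hs : (fun i => ∑ k : Fin 4, (v i k.succ - v i 0) + σ * (ε i ^ 2 * sinh (2 * v i 0))) =O[l]
      fun i => ε i ^ 3) :
    (fun i => (∑ k : Fin 4, (Complex.arg ⟨S (ε i * sinh (v i 0)), T (ε i * cosh (v i k.succ))⟩ -
        (if ε i * sinh (v i 0) < 0 then π else 0) +
        arctan (T (ε i * sinh (v i k.succ)) / S (ε i * cosh (v i 0))))) -
      (if ε i * sinh (v i 0) < 0 then -(2 * π) else 2 * π)) =O[l] fun i => ε i ^ 3 := by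
  have h := fun k => angle_isBigO hε hS hT hv0 (hv k)
  refine (((((h 0).2.add (h 1).2).add (h 2).2).add (h 3).2).add hs).congr' ?_ .rfl
  filter_upwards [eventually_all.2 fun k => (h k).1] with i hi
  simp only [Fin.sum_univ_four]
  rw [arg_mk_of_pos (hi 0), arg_mk_of_pos (hi 1), arg_mk_of_pos (hi 2), arg_mk_of_pos (hi 3)]
  split_ifs <;> ring

end families

/-! ### Rings with radii `ε sinh v`, `ε cosh v` -/

theorem norm_div_sq_add_le {ε C s t : ℝ} {P : ℂ} (hε : 0 < ε) (hst : s = ε ^ 2 * t)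
    (h : ‖P + Complex.I * (s : ℂ)‖ ≤ C * ‖ε ^ 3‖) :
    ‖P / (ε : ℂ) ^ 2 + Complex.I * (t : ℂ)‖ ≤ C * ε := by
  have hε' : (ε : ℂ) ≠ 0 := by exact_mod_cast hε.ne'
  have e : P / (ε : ℂ) ^ 2 + Complex.I * (t : ℂ) = (P + Complex.I * (s : ℂ)) / (ε : ℂ) ^ 2 := by
    rw [hst]
    push_cast
    field_simp
  rw [norm_eq_abs, abs_of_pos (pow_pos hε 3)] at h
  rw [e, norm_div, norm_pow, Complex.norm_real, norm_eq_abs, abs_of_pos hε,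
    div_le_iff₀ (by positivity)]
  linarith

theorem exists_of_eventually_nhdsGT {p : ℝ → Prop} (h : ∀ᶠ ε in 𝓝[>] (0 : ℝ), p ε) :
    ∃ ε₀ : ℝ, 0 < ε₀ ∧ ε₀ < 1 ∧ ∀ ε, 0 < ε → ε < ε₀ → p ε := by
  obtain ⟨δ, hδ, hp⟩ := mem_nhdsGT_iff_exists_Ioo_subset.1 h
  exact ⟨min δ (1 / 2), lt_min hδ (by norm_num), (min_le_right _ _).trans_lt (by norm_num),
    fun ε h0 h1 => hp ⟨h0, h1.trans_le (min_le_left _ _)⟩⟩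

section families

variable {ι : Type*} {l : Filter ι} {ε : ι → ℝ}

theorem isBigO_one_of_sub (hε : Tendsto ε l (𝓝[>] 0)) {v : ι → Fin 5 → ℝ}
    (hv0 : (fun i => v i 0) =O[l] fun _ => (1 : ℝ))
    (hv : ∀ k : Fin 4, (fun i => v i k.succ - v i 0) =O[l] ε) (j : Fin 5) :
    (fun i => v i j) =O[l] fun _ => (1 : ℝ) := by
  refine Fin.cases hv0 (fun k => ?_) j
  exact (((hv k).trans ((tendsto_zero_of_nhdsGT hε).isBigO_one ℝ)).add hv0).congr_left
    fun i => by ring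

theorem spherical_rings (hε : Tendsto ε l (𝓝[>] 0)) {v : ι → Fin 5 → ℝ}
    (hv0 : (fun i => v i 0) =O[l] fun _ => (1 : ℝ))
    (hv : ∀ k : Fin 4, (fun i => v i k.succ - v i 0) =O[l] ε)
    (hs : (fun i => ∑ k : Fin 4, (v i k.succ - v i 0) + ε i ^ 2 * sinh (2 * v i 0)) =O[l]
      fun i => ε i ^ 3) :
    ∃ C : ℝ, ∀ᶠ i in l, ∀ r R : Fin 5 → ℝ, (∀ j, r j = ε i * sinh (v i j)) →
      (∀ j, R j = ε i * cosh (v i j)) →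
      (∀ j, ∃! β : ℝ, IsSphericalVariable √(1 - ε i ^ 2) (r j) β) ∧
      (∀ β : Fin 5 → ℝ, (∀ j, IsSphericalVariable √(1 - ε i ^ 2) (r j) (β j)) →
        (∀ j, |sin (R j) - dn √(1 - ε i ^ 2) (β j)| ≤ C * ε i ^ 3) ∧
        ‖(sphericalProd √(1 - ε i ^ 2) β - 1) / (ε i : ℂ) ^ 2‖ ≤ C * ε i) ∧
      IsSphericalFlowerUpTo r R (C * ε i ^ 5) (C * ε i ^ 3) := by
  have hvj := isBigO_one_of_sub hε hv0 hv
  have hε0 := tendsto_zero_of_nhdsGT hε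
  have hpi : ∀ᶠ i in l, ∀ j, ε i * cosh (v i j) < π / 2 := by
    refine eventually_all.2 fun j => ?_
    exact ((mul_isBigO_eps (comp_isBigO_one continuous_cosh (hvj j))).trans_tendsto
      hε0).eventually_lt_const (by positivity)
  have h1 := isBigO_iff_eventually.1 (sphericalProd_isBigO hε hv0 hv hs)
  have h2 := eventually_all.2 fun j => isBigO_iff_eventually.1 (sin_sub_dn_isBigO hε (hvj j))
  have h3 := eventually_all.2 fun k => isBigO_iff_eventually.1
    (orthogonality_isBigO (σ := 1) hε (by simpa using cos_sub_isBigO_six) hv0 (hv k))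
  have h4 := isBigO_iff_eventually.1 (angle_sum_isBigO (σ := 1) hε
    (by simpa using sin_sub_isBigO_five) (by simpa using tan_sub_isBigO_five) hv0 hv
    (by simpa using hs))
  -- Every sufficiently large constant is admissible in each of the finitely many estimates, so a
  -- common C exists.
  obtain ⟨C, ⟨⟨c1, c2⟩, c3⟩, c4⟩ := (((h1.and h2).and h3).and h4).exists
  refine ⟨C, ?_⟩
  filter_upwards [c1, eventually_all.2 c2, eventually_all.2 c3, c4, hpi, eventually_pos_lt_one hε]
    with i d1 d2 d3 d4 hpi hi r R hr hR
  obtain rfl : r = fun j => ε i * sinh (v i j) := funext hr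
  obtain rfl : R = fun j => ε i * cosh (v i j) := funext hR
  have hk := sq_modulus_lt_one hi.1 hi.2
  have hrR : ∀ j, |ε i * sinh (v i j)| < ε i * cosh (v i j) := fun j => by
    rw [abs_mul, abs_of_pos hi.1]
    exact mul_lt_mul_of_pos_left (abs_sinh_lt_cosh _) hi.1
  have hiff : ∀ j β, IsSphericalVariable √(1 - ε i ^ 2) (ε i * sinh (v i j)) β ↔
      β = ellipticF √(1 - ε i ^ 2) (π / 2 - ε i * sinh (v i j)) := fun j β =>
    isSphericalVariable_iff hk ((hrR j).trans (hpi j)).le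
  have hnorm : ∀ n, ‖ε i ^ n‖ = ε i ^ n := fun n => by
    rw [norm_eq_abs, abs_of_pos (pow_pos hi.1 n)]
  refine ⟨fun j => ⟨_, (hiff j _).2 rfl, fun y hy => (hiff j y).1 hy⟩, fun β hβ => ?_,
    fun j => ⟨hrR j, hpi j⟩, fun k => ?_, ?_⟩
  · obtain rfl : β = fun j => ellipticF √(1 - ε i ^ 2) (π / 2 - ε i * sinh (v i j)) :=
      funext fun j => (hiff j _).1 (hβ j)
    refine ⟨fun j => (d2 j).trans_eq (by rw [hnorm]), ?_⟩
    simpa using norm_div_sq_add_le (s := 0) (t := 0) hi.1 (by simp) (by simpa using d1)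
  · exact (d3 k).trans_eq (by rw [hnorm])
  · exact d4.trans_eq (by rw [hnorm])

theorem hyperbolic_rings (hε : Tendsto ε l (𝓝[>] 0)) {v : ι → Fin 5 → ℝ}
    (hv0 : (fun i => v i 0) =O[l] fun _ => (1 : ℝ))
    (hv : ∀ k : Fin 4, (fun i => v i k.succ - v i 0) =O[l] ε)
    (hs : (fun i => ∑ k : Fin 4, (v i k.succ - v i 0) - ε i ^ 2 * sinh (2 * v i 0)) =O[l]
      fun i => ε i ^ 3) :
    ∃ C : ℝ, ∀ᶠ i in l, ∀ r R : Fin 5 → ℝ, (∀ j, r j = ε i * sinh (v i j)) →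
      (∀ j, R j = ε i * cosh (v i j)) →
      (∀ j, ∃! γ : ℝ, IsHyperbolicVariable √(1 - ε i ^ 2) (r j) γ) ∧
      (∀ γ : Fin 5 → ℝ, (∀ j, IsHyperbolicVariable √(1 - ε i ^ 2) (r j) (γ j)) →
        (∀ j, |cosh (R j) - 1 / (√(1 - ε i ^ 2) * sn √(1 - ε i ^ 2) (γ j))| ≤ C * ε i ^ 3 ∧
          |tanh (R j) - dn √(1 - ε i ^ 2) (γ j)| ≤ C * ε i ^ 3) ∧
        ‖(hyperbolicProd √(1 - ε i ^ 2) γ - 1) / (ε i : ℂ) ^ 2‖ ≤ C * ε i) ∧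
      IsHyperbolicFlowerUpTo r R (C * ε i ^ 5) (C * ε i ^ 3) := by
  have hvj := isBigO_one_of_sub hε hv0 hv
  have h1 := isBigO_iff_eventually.1 (hyperbolicProd_isBigO hε hv0 hv hs)
  have h2 := eventually_all.2 fun j => isBigO_iff_eventually.1 (cosh_sub_sn_isBigO hε (hvj j))
  have h2' := eventually_all.2 fun j => isBigO_iff_eventually.1 (tanh_sub_dn_isBigO hε (hvj j))
  have h3 := eventually_all.2 fun k => isBigO_iff_eventually.1
    (orthogonality_isBigO (σ := -1) hε
      (cosh_sub_isBigO_six.congr_left fun x => by ring) hv0 (hv k))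
  have h4 := isBigO_iff_eventually.1 (angle_sum_isBigO (σ := -1) hε
    (sinh_sub_isBigO_five.congr_left fun x => by ring)
    (tanh_sub_isBigO_five.congr_left fun x => by ring) hv0 hv
    (hs.congr_left fun i => by rw [neg_one_mul, ← sub_eq_add_neg]))
  obtain ⟨C, ⟨⟨⟨c1, c2⟩, c2'⟩, c3⟩, c4⟩ := ((((h1.and h2).and h2').and h3).and h4).exists
  refine ⟨C, ?_⟩
  filter_upwards [c1, eventually_all.2 c2, eventually_all.2 c2', eventually_all.2 c3, c4,
    eventually_pos_lt_one hε] with i d1 d2 d2' d3 d4 hi r R hr hR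
  obtain rfl : r = fun j => ε i * sinh (v i j) := funext hr
  obtain rfl : R = fun j => ε i * cosh (v i j) := funext hR
  have hk := sq_modulus_lt_one hi.1 hi.2
  have hrR : ∀ j, |ε i * sinh (v i j)| < ε i * cosh (v i j) := fun j => by
    rw [abs_mul, abs_of_pos hi.1]
    exact mul_lt_mul_of_pos_left (abs_sinh_lt_cosh _) hi.1
  have hiff : ∀ j γ, IsHyperbolicVariable √(1 - ε i ^ 2) (ε i * sinh (v i j)) γ ↔
      γ = ellipticF √(1 - ε i ^ 2) (π / 2 - arctan (sinh (ε i * sinh (v i j)))) := fun j γ =>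
    isHyperbolicVariable_iff hk
  have hnorm : ∀ n, ‖ε i ^ n‖ = ε i ^ n := fun n => by
    rw [norm_eq_abs, abs_of_pos (pow_pos hi.1 n)]
  refine ⟨fun j => ⟨_, (hiff j _).2 rfl, fun y hy => (hiff j y).1 hy⟩, fun γ hγ => ?_,
    fun j => hrR j, fun k => ?_, ?_⟩
  · obtain rfl : γ = fun j => ellipticF √(1 - ε i ^ 2)
        (π / 2 - arctan (sinh (ε i * sinh (v i j)))) :=
      funext fun j => (hiff j _).1 (hγ j)
    refine ⟨fun j => ⟨(d2 j).trans_eq (by rw [hnorm]), (d2' j).trans_eq (by rw [hnorm])⟩, ?_⟩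
    simpa using norm_div_sq_add_le (s := 0) (t := 0) hi.1 (by simp) (by simpa using d1)
  · exact (d3 k).trans_eq (by rw [hnorm])
  · exact d4.trans_eq (by rw [hnorm])

end families

/-! ### The expansion of the ring equations with explicit constants -/

theorem ring_equations_expansion (M A B : ℝ) : ∃ C ε₀ : ℝ, 0 < ε₀ ∧ ε₀ < 1 ∧
    ∀ ε : ℝ, 0 < ε → ε < ε₀ →
      ∀ q : ℝ, q = √(1 - ε ^ 2) → ∀ w : Fin 5 → ℝ, |w 0| ≤ M →
        (∀ k : Fin 4, |w k.succ - w 0| ≤ A * ε) →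
        |∑ k : Fin 4, (w k.succ - w 0)| ≤ B * ε ^ 2 →
        ‖(sphericalProd q (fun j => ellipticK q - w j) - 1) / (ε : ℂ) ^ 2 +
            Complex.I * (((∑ k : Fin 4, (w k.succ - w 0)) / ε ^ 2 +
              sinh (2 * w 0) : ℝ) : ℂ)‖ ≤ C * ε ∧
        ‖(hyperbolicProd q (fun j => ellipticK q - w j) - 1) / (ε : ℂ) ^ 2 +
            Complex.I * (((∑ k : Fin 4, (w k.succ - w 0)) / ε ^ 2 -
              sinh (2 * w 0) : ℝ) : ℂ)‖ ≤ C * ε := by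
  -- The constraints depend on ε, so the admissible pairs (ε, w) form a principal filter on the
  -- whole space rather than a factor of a product; estimates along this filter are uniform in w.
  let l : Filter (ℝ × (Fin 5 → ℝ)) := comap Prod.fst (𝓝[>] 0) ⊓ 𝓟 {i | |i.2 0| ≤ M ∧
    (∀ k : Fin 4, |i.2 k.succ - i.2 0| ≤ A * i.1) ∧
      |∑ k : Fin 4, (i.2 k.succ - i.2 0)| ≤ B * i.1 ^ 2}
  have hε : Tendsto Prod.fst l (𝓝[>] 0) := tendsto_comap.mono_left inf_le_left
  have hT : ∀ᶠ i in l, |i.2 0| ≤ M ∧ (∀ k : Fin 4, |i.2 k.succ - i.2 0| ≤ A * i.1) ∧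
      |∑ k : Fin 4, (i.2 k.succ - i.2 0)| ≤ B * i.1 ^ 2 :=
    mem_inf_of_right (mem_principal_self _)
  have hpos := eventually_pos_lt_one hε
  have h := ringProd_sub_isBigO hε (w := fun i => i.2)
    (IsBigO.of_bound M (hT.mono fun i hi => by simpa using hi.1))
    (fun k => IsBigO.of_bound A ((hT.and hpos).mono fun i hi => by
      rw [norm_eq_abs, norm_eq_abs, abs_of_pos hi.2.1]
      exact hi.1.2.1 k))
    (IsBigO.of_bound B ((hT.and hpos).mono fun i hi => by
      rw [norm_eq_abs, norm_eq_abs, abs_of_pos (pow_pos hi.2.1 2)]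
      exact hi.1.2.2))
  obtain ⟨C, h1, h2⟩ := ((isBigO_iff_eventually.1 h.1).and (isBigO_iff_eventually.1 h.2)).exists
  have h3 := h1.and h2
  rw [eventually_inf_principal, eventually_comap] at h3
  obtain ⟨ε₀, p0, p1, hp⟩ := exists_of_eventually_nhdsGT h3
  refine ⟨C, ε₀, p0, p1, ?_⟩
  rintro ε h0 hlt q rfl w hw0 hwk hws
  have h4 := hp ε h0 hlt (ε, w) rfl ⟨hw0, hwk, hws⟩
  have hne : ε ^ 2 ≠ 0 := (pow_pos h0 2).ne'
  exact ⟨norm_div_sq_add_le h0 (by field_simp) h4.1, norm_div_sq_add_le h0 (by field_simp) h4.2⟩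

end RingPattern

/-! ### Assembly of the theorem. -/

open RingPattern Filter Topology Asymptotics in
theorem mainTheorem11 :
    -- the discrete equations in the limit `u_k - u = O(ε)`, `∑ (u_k - u) = O(ε²)`
    (∀ M A B : ℝ, ∃ C ε₀ : ℝ, 0 < ε₀ ∧ ε₀ < 1 ∧ ∀ ε : ℝ, 0 < ε → ε < ε₀ →
      ∀ q : ℝ, q = √(1 - ε ^ 2) → ∀ w : Fin 5 → ℝ, |w 0| ≤ M →
        (∀ k : Fin 4, |w k.succ - w 0| ≤ A * ε) →
        |∑ k : Fin 4, (w k.succ - w 0)| ≤ B * ε ^ 2 →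
        ‖(RingPattern.sphericalProd q (fun j => RingPattern.ellipticK q - w j) - 1) / (ε : ℂ) ^ 2 +
            Complex.I * (((∑ k : Fin 4, (w k.succ - w 0)) / ε ^ 2 +
              Real.sinh (2 * w 0) : ℝ) : ℂ)‖ ≤ C * ε ∧
        ‖(RingPattern.hyperbolicProd q (fun j => RingPattern.ellipticK q - w j) - 1) / (ε : ℂ) ^ 2 +
            Complex.I * (((∑ k : Fin 4, (w k.succ - w 0)) / ε ^ 2 -
              Real.sinh (2 * w 0) : ℝ) : ℂ)‖ ≤ C * ε) ∧
    ∀ (U : Set (EuclideanSpace ℝ (Fin 2))) (u : EuclideanSpace ℝ (Fin 2) → ℝ),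
      IsOpen U → ContDiffOn ℝ 3 u U →
      ∀ S : Set (EuclideanSpace ℝ (Fin 2)), IsCompact S → S ⊆ U →
      -- the equations for `u` sampled on the lattice of mesh size `ε`
      (∃ C ε₀ : ℝ, 0 < ε₀ ∧ ε₀ < 1 ∧ ∀ ε : ℝ, 0 < ε → ε < ε₀ →
        ∀ q : ℝ, q = √(1 - ε ^ 2) → ∀ p ∈ S,
          (∀ j, RingPattern.stencil ε p j ∈ U) ∧
          ‖(RingPattern.sphericalProd q
                (fun j => RingPattern.ellipticK q - u (RingPattern.stencil ε p j)) - 1) /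
                (ε : ℂ) ^ 2 +
              Complex.I * ((Laplacian.laplacian u p + Real.sinh (2 * u p) : ℝ) : ℂ)‖
            ≤ C * ε ∧
          ‖(RingPattern.hyperbolicProd q
                (fun j => RingPattern.ellipticK q - u (RingPattern.stencil ε p j)) - 1) /
                (ε : ℂ) ^ 2 +
              Complex.I * ((Laplacian.laplacian u p - Real.sinh (2 * u p) : ℝ) : ℂ)‖
            ≤ C * ε) ∧
      -- rings with the radii `ε sinh u`, `ε cosh u`, spherical case
      ((∀ p ∈ U, Laplacian.laplacian u p + Real.sinh (2 * u p) = 0) →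
        ∃ C ε₀ : ℝ, 0 < ε₀ ∧ ε₀ < 1 ∧ ∀ ε : ℝ, 0 < ε → ε < ε₀ →
        ∀ q : ℝ, q = √(1 - ε ^ 2) → ∀ p ∈ S, ∀ r R : Fin 5 → ℝ,
          (∀ j, r j = ε * Real.sinh (u (RingPattern.stencil ε p j))) →
          (∀ j, R j = ε * Real.cosh (u (RingPattern.stencil ε p j))) →
          (∀ j, RingPattern.stencil ε p j ∈ U) ∧
          (∀ j, ∃! β : ℝ, RingPattern.IsSphericalVariable q (r j) β) ∧
          (∀ β : Fin 5 → ℝ, (∀ j, RingPattern.IsSphericalVariable q (r j) (β j)) →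
            (∀ j, |Real.sin (R j) - RingPattern.dn q (β j)| ≤ C * ε ^ 3) ∧
            ‖(RingPattern.sphericalProd q β - 1) / (ε : ℂ) ^ 2‖ ≤ C * ε) ∧
          RingPattern.IsSphericalFlowerUpTo r R (C * ε ^ 5) (C * ε ^ 3)) ∧
      -- rings with the radii `ε sinh u`, `ε cosh u`, hyperbolic case
      ((∀ p ∈ U, Laplacian.laplacian u p - Real.sinh (2 * u p) = 0) →
        ∃ C ε₀ : ℝ, 0 < ε₀ ∧ ε₀ < 1 ∧ ∀ ε : ℝ, 0 < ε → ε < ε₀ →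
        ∀ q : ℝ, q = √(1 - ε ^ 2) → ∀ p ∈ S, ∀ r R : Fin 5 → ℝ,
          (∀ j, r j = ε * Real.sinh (u (RingPattern.stencil ε p j))) →
          (∀ j, R j = ε * Real.cosh (u (RingPattern.stencil ε p j))) →
          (∀ j, RingPattern.stencil ε p j ∈ U) ∧
          (∀ j, ∃! γ : ℝ, RingPattern.IsHyperbolicVariable q (r j) γ) ∧
          (∀ γ : Fin 5 → ℝ, (∀ j, RingPattern.IsHyperbolicVariable q (r j) (γ j)) →
            (∀ j, |Real.cosh (R j) - 1 / (q * RingPattern.sn q (γ j))| ≤ C * ε ^ 3 ∧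
              |Real.tanh (R j) - RingPattern.dn q (γ j)| ≤ C * ε ^ 3) ∧
            ‖(RingPattern.hyperbolicProd q γ - 1) / (ε : ℂ) ^ 2‖ ≤ C * ε) ∧
          RingPattern.IsHyperbolicFlowerUpTo r R (C * ε ^ 5) (C * ε ^ 3)) := by
  refine ⟨ring_equations_expansion, fun U u hU hu S hS hSU => ?_⟩
  have hε : Tendsto Prod.fst (𝓝[>] (0 : ℝ) ×ˢ 𝓟 S) (𝓝[>] 0) := tendsto_fst
  obtain ⟨hmem, hv0, hvk, hΔ, hsum⟩ := stencil_expansion hU hu hS hSU rfl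
  have hpos := eventually_pos_lt_one hε
  have hev : ∀ {p : ℝ × EuclideanSpace ℝ (Fin 2) → Prop},
      (∀ᶠ i in 𝓝[>] (0 : ℝ) ×ˢ 𝓟 S, p i) →
      ∃ ε₀ : ℝ, 0 < ε₀ ∧ ε₀ < 1 ∧ ∀ ε, 0 < ε → ε < ε₀ → ∀ x ∈ S, p (ε, x) := fun h =>
    exists_of_eventually_nhdsGT (eventually_prod_principal_iff.1 h)
  refine ⟨?_, fun heq => ?_, fun heq => ?_⟩
  · have hs : (fun i : ℝ × EuclideanSpace ℝ (Fin 2) =>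
        ∑ k : Fin 4, (u (stencil i.1 i.2 k.succ) - u (stencil i.1 i.2 0)))
        =O[𝓝[>] (0 : ℝ) ×ˢ 𝓟 S] fun i => i.1 ^ 2 :=
      ((hsum.trans (pow_isBigO_pow hε (by norm_num))).add
        (((isBigO_refl (fun i : ℝ × EuclideanSpace ℝ (Fin 2) => i.1 ^ 2) _).mul hΔ).congr_right
          fun i => mul_one _)).congr_left fun i => by ring
    have h := ringProd_sub_isBigO hε (w := fun i j => u (stencil i.1 i.2 j)) hv0 hvk hs
    -- Replaces the sum of differences by ε²Δu at the cost of O(ε³).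
    have hI : (fun i : ℝ × EuclideanSpace ℝ (Fin 2) => Complex.I *
        ((∑ k : Fin 4, (u (stencil i.1 i.2 k.succ) - u (stencil i.1 i.2 0)) -
          i.1 ^ 2 * Laplacian.laplacian u i.2 : ℝ) : ℂ)) =O[𝓝[>] (0 : ℝ) ×ˢ 𝓟 S]
            fun i => i.1 ^ 3 := by
      refine IsBigO.trans (IsBigO.of_bound 1 (.of_forall fun i => ?_)) hsum
      rw [norm_mul, Complex.norm_real, Complex.norm_I]
    obtain ⟨C, h1, h2⟩ := ((isBigO_iff_eventually.1 (h.1.sub hI)).and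
      (isBigO_iff_eventually.1 (h.2.sub hI))).exists
    obtain ⟨ε₀, p0, p1, hp⟩ := hev ((hmem.and h1).and h2)
    refine ⟨C, ε₀, p0, p1, ?_⟩
    rintro ε h0 hlt q rfl p hpS
    obtain ⟨⟨g0, g1⟩, g2⟩ := hp ε h0 hlt p hpS
    refine ⟨g0, ?_, ?_⟩
    · refine norm_div_sq_add_le h0 rfl (le_of_eq_of_le ?_ g1)
      congr 1
      simp only [show stencil ε p 0 = p from rfl]
      push_cast
      ring
    · refine norm_div_sq_add_le h0 rfl (le_of_eq_of_le ?_ g2)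
      congr 1
      simp only [show stencil ε p 0 = p from rfl]
      push_cast
      ring
  · have hS' : ∀ᶠ i in 𝓝[>] (0 : ℝ) ×ˢ 𝓟 S, i.2 ∈ S :=
      eventually_prod_principal_iff.2 (.of_forall fun _ _ h => h)
    obtain ⟨C, hC⟩ := spherical_rings hε (v := fun i j => u (stencil i.1 i.2 j)) hv0 hvk
      -- By the differential equation -ε²Δu = ε² sinh(2u), so the Taylor remainder is exactly the
      -- combination required to be O(ε³).
      (hsum.congr' (hS'.mono fun i hi => by
        have := heq i.2 (hSU hi)
        simp only [show stencil i.1 i.2 0 = i.2 from rfl]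
        linear_combination (-i.1 ^ 2) * this) .rfl)
    obtain ⟨ε₀, p0, p1, hp⟩ := hev (hmem.and hC)
    refine ⟨C, ε₀, p0, p1, ?_⟩
    rintro ε h0 hlt q rfl p hpS r R hr hR
    exact ⟨(hp ε h0 hlt p hpS).1, (hp ε h0 hlt p hpS).2 r R hr hR⟩
  · have hS' : ∀ᶠ i in 𝓝[>] (0 : ℝ) ×ˢ 𝓟 S, i.2 ∈ S :=
      eventually_prod_principal_iff.2 (.of_forall fun _ _ h => h)
    obtain ⟨C, hC⟩ := hyperbolic_rings hε (v := fun i j => u (stencil i.1 i.2 j)) hv0 hvk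
      (hsum.congr' (hS'.mono fun i hi => by
        have := heq i.2 (hSU hi)
        simp only [show stencil i.1 i.2 0 = i.2 from rfl]
        linear_combination (-i.1 ^ 2) * this) .rfl)
    obtain ⟨ε₀, p0, p1, hp⟩ := hev (hmem.and hC)
    refine ⟨C, ε₀, p0, p1, ?_⟩
    rintro ε h0 hlt q rfl p hpS r R hr hR
    exact ⟨(hp ε h0 hlt p hpS).1, (hp ε h0 hlt p hpS).2 r R hr hR⟩
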